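/- Let $K$ be a field of characteristic $0$ with $n$ commuting derivations $\partial_1,\dots,\partial_n$, and let $D=K[d_1,\dots,d_n]$ be the ring of differential operators, generated by $K$ and commuting symbols $d_i$ with $d_ia=ad_i+\partial_ia$. Let $J_q(E)$ be the $K$-vector space of jets $(v^k_\mu)$, $1\le k\le m$, $|\mu|\le q$, and let $R_q\subset J_q(E)$ be a linear system of order $q$, with equations $\Phi:\ a^\mu_k y^k_\mu=0$. Let $R_{q+1}\subset J_{q+1}(E)$ be its first prolongation, given by $a^\mu_ky^k_\mu=0$ and $a^\mu_ky^k_{\mu+1_i}+(\partial_ia^\mu_k)y^k_\mu=0$ for $1\le i\le n$, and let $g_q\subset R_q$, $g_{q+1}\subset R_{q+1}$ be the symbols (jets with vanishing components of order $<q$, resp. $<q+1$). Suppose that $R_q$ is involutive, that is, $R_{q+1}\to R_q$ is surjective and, after some linear change of the independent variables with constant coefficients, $\dim g_{q+1}=\sum_{i=0}^{n-1}\dim g_q^{(i)}$, where $g_q^{(i)}$ is the set of elements of $g_q$ whose components $v^k_\mu$ with $\mu_j\neq 0$ for some $j\le i$ vanish (for $q\ge1$ the sum equals $\sum_{i=1}^n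 i\,\alpha^i_q$ with the characters $\alpha^i_q=\dim g_q^{(i-1)}-\dim g_q^{(i)}$). Let $M=D^m/D\Phi$ be the left $D$-module defined by the system, where $D\Phi$ is the submodule generated by all equations of $R_q$, and let $M_r\subset M$ be the $K$-span of the residues of the $y^k_\mu$ with $|\mu|\le r$. Let $R=\hom_K(M,K)$ be the inverse system, a left $D$-module for $(af)(x)=af(x)$ and the Spencer operator $(d_if)(x)=\partial_i(f(x))-f(d_ix)$; it is the projective limit of the spaces $\hom_K(M_r,K)$. Then $R$ is generated over $D$, as a projective limit, by a finite basis of sections containing $\dim_K(R_q)$ generators. That is, there are $N=\dim_K(R_q)$ sections $f_1,\dots,f_N\in R$, linearly independent over $K$, such that for every $r\ge0$ the restriction map $Df_1+\dots+Df_N\to\hom_K(M_r,K)$ is surjective. In particular, if $\dim_K M<\infty$, then $R=Df_1+\dots+Df_N$. -/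

import Mathlib

noncomputable section

/-- A field with `n` pairwise commuting derivations `∂₁, …, ∂ₙ` (indexed by `Fin n`). -/
class PartialDifferentialField (n : ℕ) (K : Type*) [Field K] where
  der : Fin n → Derivation ℤ K K
  der_comm : ∀ i j a, der i (der j a) = der j (der i a)

/-- The derivation `∂ᵢ` of the differential field `K`. -/
abbrev pd {n : ℕ} {K : Type*} [Field K] [PartialDifferentialField n K] (i : Fin n) :
    Derivation ℤ K K := PartialDifferentialField.der i

section DiffOp

variable (n : ℕ) (K : Type*) [Field K] [PartialDifferentialField n K]

/-- The defining relations of `D = K[d₁, …, dₙ]`: the generators are the elements of `K`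
(`Sum.inl a`) and the symbols `dᵢ` (`Sum.inr i`). -/
inductive DiffOp.Rel : FreeAlgebra ℤ (K ⊕ Fin n) → FreeAlgebra ℤ (K ⊕ Fin n) → Prop
  | add (a b : K) : DiffOp.Rel (FreeAlgebra.ι ℤ (Sum.inl (a + b)))
      (FreeAlgebra.ι ℤ (Sum.inl a) + FreeAlgebra.ι ℤ (Sum.inl b))
  | mul (a b : K) : DiffOp.Rel (FreeAlgebra.ι ℤ (Sum.inl (a * b)))
      (FreeAlgebra.ι ℤ (Sum.inl a) * FreeAlgebra.ι ℤ (Sum.inl b))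
  | one : DiffOp.Rel (FreeAlgebra.ι ℤ (Sum.inl (1 : K))) 1
  | comm (i j : Fin n) : DiffOp.Rel
      (FreeAlgebra.ι ℤ (Sum.inr i) * FreeAlgebra.ι ℤ (Sum.inr j))
      (FreeAlgebra.ι ℤ (Sum.inr j) * FreeAlgebra.ι ℤ (Sum.inr i))
  | leibniz (i : Fin n) (a : K) : DiffOp.Rel
      (FreeAlgebra.ι ℤ (Sum.inr i) * FreeAlgebra.ι ℤ (Sum.inl a))
      (FreeAlgebra.ι ℤ (Sum.inl a) * FreeAlgebra.ι ℤ (Sum.inr i)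
        + FreeAlgebra.ι ℤ (Sum.inl (pd i a)))

/-- The noncommutative ring `D = K[d₁, …, dₙ]` of differential operators: it is generated by the
field `K` and commuting symbols `dᵢ`, with the relations `dᵢ a = a dᵢ + ∂ᵢ a`. -/
def DiffOp : Type _ := RingQuot (DiffOp.Rel n K)

instance : Ring (DiffOp n K) := inferInstanceAs (Ring (RingQuot (DiffOp.Rel n K)))

namespace DiffOp

/-- The quotient map from the free ring. -/
def mk : FreeAlgebra ℤ (K ⊕ Fin n) →+* DiffOp n K := RingQuot.mkRingHom (DiffOp.Rel n K)

variable {n K}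

theorem mk_rel {x y : FreeAlgebra ℤ (K ⊕ Fin n)} (h : Rel n K x y) : mk n K x = mk n K y :=
  RingQuot.mkRingHom_rel h

variable (n) in
/-- The inclusion of the coefficient field `K` in `D`, as operators of order zero. -/
def coef : K →+* DiffOp n K where
  toFun a := mk n K (FreeAlgebra.ι ℤ (Sum.inl a))
  map_one' := by rw [mk_rel Rel.one, map_one]
  map_mul' a b := by rw [mk_rel (Rel.mul a b), map_mul]
  map_add' a b := by rw [mk_rel (Rel.add a b), map_add]
  map_zero' := by
    have h := mk_rel (n := n) (Rel.add (0 : K) 0)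
    rw [add_zero, map_add] at h
    exact left_eq_add.mp h

variable (K) in
/-- The operator `dᵢ ∈ D`. -/
def d (i : Fin n) : DiffOp n K := mk n K (FreeAlgebra.ι ℤ (Sum.inr i))

theorem d_mul_d (i j : Fin n) : d K i * d K j = d K j * d K i := by
  simpa only [d, ← map_mul] using mk_rel (Rel.comm (K := K) i j)

theorem d_mul_coef (i : Fin n) (a : K) :
    d K i * coef n a = coef n a * d K i + coef n (pd i a) := by
  change mk n K _ * mk n K _ = mk n K _ * mk n K _ + mk n K _
  rw [← map_mul, ← map_mul, ← map_add]
  exact mk_rel (Rel.leibniz i a)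

/-- `D` is a left vector space over `K` through left multiplication. -/
instance : Module K (DiffOp n K) := Module.compHom _ (coef n)

theorem smul_def (a : K) (P : DiffOp n K) : a • P = coef n a * P := rfl

instance : IsScalarTower K (DiffOp n K) (DiffOp n K) :=
  ⟨fun a P Q => by simp only [smul_def, smul_eq_mul, mul_assoc]⟩

/-- The monomial `d^μ = d₁^μ₁ ⋯ dₙ^μₙ`. -/
def monomial (μ : Fin n → ℕ) : DiffOp n K := (List.ofFn fun i => d K i ^ μ i).prod

/-- Universal property of `D`: a ring map out of `D` is given by a ring map on `K` and images of
the `dᵢ` that satisfy the defining relations. -/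
def lift {B : Type*} [Ring B] (φ : K →+* B) (δ : Fin n → B)
    (hcomm : ∀ i j, δ i * δ j = δ j * δ i)
    (hleib : ∀ i a, δ i * φ a = φ a * δ i + φ (pd i a)) : DiffOp n K →+* B :=
  RingQuot.lift ⟨(FreeAlgebra.lift ℤ (Sum.elim φ δ)).toRingHom, by
    intro x y h
    cases h <;> simp [hcomm, hleib]⟩

@[simp] theorem lift_coef {B : Type*} [Ring B] (φ : K →+* B) (δ : Fin n → B)
    (hcomm : ∀ i j, δ i * δ j = δ j * δ i)
    (hleib : ∀ i a, δ i * φ a = φ a * δ i + φ (pd i a)) (a : K) :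
    lift φ δ hcomm hleib (coef n a) = φ a := by
  change RingQuot.lift _ (RingQuot.mkRingHom _ _) = _
  rw [RingQuot.lift_mkRingHom_apply]
  simp

@[simp] theorem lift_d {B : Type*} [Ring B] (φ : K →+* B) (δ : Fin n → B)
    (hcomm : ∀ i j, δ i * δ j = δ j * δ i)
    (hleib : ∀ i a, δ i * φ a = φ a * δ i + φ (pd i a)) (i : Fin n) :
    lift φ δ hcomm hleib (d K i) = δ i := by
  change RingQuot.lift _ (RingQuot.mkRingHom _ _) = _
  rw [RingQuot.lift_mkRingHom_apply]
  simp

end DiffOp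

end DiffOp

section InverseSystem

variable {n : ℕ} {K : Type*} [Field K] [PartialDifferentialField n K]
  {M : Type*} [AddCommGroup M] [Module K M] [Module (DiffOp n K) M]
  [IsScalarTower K (DiffOp n K) M]

theorem DiffOp.coef_smul (a : K) (x : M) : DiffOp.coef n a • x = a • x := by
  rw [← mul_one (DiffOp.coef n a), ← DiffOp.smul_def, smul_assoc, one_smul]

theorem DiffOp.d_smul_smul (i : Fin n) (a : K) (x : M) :
    DiffOp.d K i • a • x = a • DiffOp.d K i • x + (pd i a) • x := by
  rw [← DiffOp.coef_smul (n := n) a x, ← mul_smul, DiffOp.d_mul_coef, add_smul, mul_smul,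
    DiffOp.coef_smul, DiffOp.coef_smul]

/-- The Spencer operator `dᵢ` on `R = hom_K(M, K)`: `(dᵢ f)(x) = ∂ᵢ (f x) - f (dᵢ x)`. -/
def spencer (i : Fin n) (f : M →ₗ[K] K) : M →ₗ[K] K where
  toFun x := pd i (f x) - f (DiffOp.d K i • x)
  map_add' x y := by simp only [map_add, smul_add]; ring
  map_smul' a x := by
    simp only [DiffOp.d_smul_smul, map_add, map_smul, smul_eq_mul, Derivation.leibniz,
      RingHom.id_apply]
    ring

theorem spencer_apply (i : Fin n) (f : M →ₗ[K] K) (x : M) :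
    spencer i f x = pd i (f x) - f (DiffOp.d K i • x) := rfl

variable (M) in
/-- The Spencer operator as an additive endomorphism of `hom_K(M, K)`. -/
def spencerEnd (i : Fin n) : AddMonoid.End (M →ₗ[K] K) where
  toFun := spencer i
  map_zero' := by ext x; simp [spencer_apply]
  map_add' f g := by ext x; simp [spencer_apply]; ring

theorem spencerEnd_apply (i : Fin n) (f : M →ₗ[K] K) : spencerEnd M i f = spencer i f := rfl

theorem spencerEnd_comm (i j : Fin n) :
    spencerEnd M i * spencerEnd (K := K) M j = spencerEnd M j * spencerEnd M i := by
  refine DFunLike.ext _ _ fun f : M →ₗ[K] K => LinearMap.ext fun x => ?_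
  change spencer i (spencer j f) x = spencer j (spencer i f) x
  simp only [spencer_apply, map_sub, ← mul_smul]
  rw [DiffOp.d_mul_d i j, PartialDifferentialField.der_comm i j]
  ring

theorem spencerEnd_leibniz (i : Fin n) (a : K) :
    spencerEnd M i * Module.toAddMonoidEnd K (M →ₗ[K] K) a =
      Module.toAddMonoidEnd K (M →ₗ[K] K) a * spencerEnd M i +
        Module.toAddMonoidEnd K (M →ₗ[K] K) (pd i a) := by
  refine DFunLike.ext _ _ fun f : M →ₗ[K] K => LinearMap.ext fun x => ?_
  change spencer i (a • f) x = (a • spencer i f + pd i a • f) x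
  simp only [spencer_apply, LinearMap.add_apply, LinearMap.smul_apply, smul_eq_mul,
    Derivation.leibniz]
  ring

variable (n K M) in
/-- The action of `D` on the inverse system `R = hom_K(M, K)` of a left `D`-module `M`: elements
of `K` act by `(a f)(x) = a f(x)` and the `dᵢ` act by the Spencer operator. -/
def spencerAction : DiffOp n K →+* AddMonoid.End (M →ₗ[K] K) :=
  DiffOp.lift (n := n) (K := K) (B := AddMonoid.End (M →ₗ[K] K))
    (Module.toAddMonoidEnd K (M →ₗ[K] K)) (spencerEnd M) spencerEnd_comm
    spencerEnd_leibniz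

/-- The left `D`-module structure on the inverse system `R = hom_K(M, K)`. -/
instance inverseSystemModule : Module (DiffOp n K) (M →ₗ[K] K) :=
  Module.compHom _ (spencerAction n K M)

theorem d_smul_apply (i : Fin n) (f : M →ₗ[K] K) (x : M) :
    (DiffOp.d K i • f) x = pd i (f x) - f (DiffOp.d K i • x) := by
  change spencerAction n K M (DiffOp.d K i) f x = _
  rw [spencerAction, DiffOp.lift_d]
  rfl

theorem coef_smul_apply (a : K) (f : M →ₗ[K] K) (x : M) :
    (DiffOp.coef n a • f) x = a * f x := by
  change spencerAction n K M (DiffOp.coef n a) f x = _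
  rw [spencerAction, DiffOp.lift_coef]
  rfl

end InverseSystem

/-- The length `|μ|` of a multi-index. -/
def mlen {n : ℕ} (μ : Fin n → ℕ) : ℕ := ∑ i, μ i

theorem mlen_add_single {n : ℕ} (μ : Fin n → ℕ) (i : Fin n) :
    mlen (μ + Pi.single i 1) = mlen μ + 1 := by
  simp [mlen, Finset.sum_add_distrib]

/-- The multi-indices of length at most `q`. -/
abbrev MIdx (n q : ℕ) : Type := {μ : Fin n → ℕ // mlen μ ≤ q}

instance (n q : ℕ) : Fintype (MIdx n q) :=
  Set.Finite.fintype (s := {μ : Fin n → ℕ | mlen μ ≤ q})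
    ((Set.finite_Iic (fun _ : Fin n => q)).subset fun μ hμ i =>
      (Finset.single_le_sum (f := μ) (fun _ _ => Nat.zero_le _) (Finset.mem_univ i)).trans hμ)

/-- `μ`, seen as a multi-index of length at most `q + 1`. -/
def MIdx.up {n q : ℕ} (μ : MIdx n q) : MIdx n (q + 1) := ⟨μ.1, μ.2.trans (Nat.le_succ q)⟩

/-- The multi-index `μ + 1ᵢ`. -/
def MIdx.inc {n q : ℕ} (μ : MIdx n q) (i : Fin n) : MIdx n (q + 1) :=
  ⟨μ.1 + Pi.single i 1, by rw [mlen_add_single]; exact Nat.succ_le_succ μ.2⟩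

/-- The jet space `J_q(E)` over `K` with `m` unknowns: families `(v^k_μ)` with `|μ| ≤ q`. -/
abbrev Jet (K : Type*) (n m q : ℕ) : Type _ := Fin m → MIdx n q → K

section System

variable {n m q : ℕ} {K : Type*} [Field K]

/-- The linear equations `∑ a_k^μ y^k_μ = 0` that hold on `R`. -/
def equations (R : Submodule K (Jet K n m q)) : Submodule K (Jet K n m q) where
  carrier := {a | ∀ v ∈ R, ∑ k, ∑ μ, a k μ * v k μ = 0}
  zero_mem' := by intro v _; simp
  add_mem' := by
    intro a b ha hb v hv
    simp [add_mul, Finset.sum_add_distrib, ha v hv, hb v hv]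
  smul_mem' := by
    intro c a ha v hv
    simp [mul_assoc, ← Finset.mul_sum, ha v hv]

/-- The projection `J_{q+1}(E) → J_q(E)`. -/
def jetProj : Jet K n m (q + 1) →ₗ[K] Jet K n m q where
  toFun w k μ := w k μ.up
  map_add' _ _ := rfl
  map_smul' _ _ := rfl

/-- The symbol `g_q ⊂ R_q`: the jets in `R_q` whose components of order `< q` vanish. -/
def symbol (R : Submodule K (Jet K n m q)) : Submodule K (Jet K n m q) where
  carrier := {v | v ∈ R ∧ ∀ k μ, mlen μ.1 < q → v k μ = 0}
  zero_mem' := ⟨R.zero_mem, fun _ _ _ => rfl⟩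
  add_mem' := by
    rintro v w ⟨hv, hv'⟩ ⟨hw, hw'⟩
    exact ⟨R.add_mem hv hw, fun k μ h => by simp [hv' k μ h, hw' k μ h]⟩
  smul_mem' := by
    rintro c v ⟨hv, hv'⟩
    exact ⟨R.smul_mem c hv, fun k μ h => by simp [hv' k μ h]⟩

/-- Let `ξ_j = ∑_l A_{jl} ∂_l` be a frame. This is the space of all `v ∈ g_q` whose contractions
with `ξ_1, …, ξ_i` vanish; in coordinates adapted to the frame these are the elements of `g_q`
whose components of class `1, …, i` vanish. -/
def symbolClass (R : Submodule K (Jet K n m q)) (A : Matrix (Fin n) (Fin n) K) (i : ℕ) :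
    Submodule K (Jet K n m q) where
  carrier := {v | v ∈ symbol R ∧ ∀ j : Fin n, j.1 < i → ∀ k, ∀ ν : Fin n → ℕ,
    ∀ hν : mlen ν < q,
      ∑ l, A j l * v k ⟨ν + Pi.single l 1, (mlen_add_single ν l).trans_le hν⟩ = 0}
  zero_mem' := ⟨Submodule.zero_mem _, by intros; simp⟩
  add_mem' := by
    rintro v w ⟨hv, hv'⟩ ⟨hw, hw'⟩
    refine ⟨Submodule.add_mem _ hv hw, fun j hj k ν hν => ?_⟩
    simp [mul_add, Finset.sum_add_distrib, hv' j hj k ν hν, hw' j hj k ν hν]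
  smul_mem' := by
    rintro c v ⟨hv, hv'⟩
    refine ⟨Submodule.smul_mem _ c hv, fun j hj k ν hν => ?_⟩
    simp [mul_left_comm _ c, ← Finset.mul_sum, hv' j hj k ν hν]

variable [PartialDifferentialField n K]

/-- The first prolongation `R_{q+1} ⊂ J_{q+1}(E)`: every equation `∑ a_k^μ y^k_μ = 0` of `R_q` is
kept, and `∑ (a_k^μ y^k_{μ+1ᵢ} + ∂ᵢ a_k^μ y^k_μ) = 0` is added for each `i`. -/
def prolong (R : Submodule K (Jet K n m q)) : Submodule K (Jet K n m (q + 1)) where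
  carrier := {w | ∀ a ∈ equations R, ∑ k, ∑ μ, a k μ * w k μ.up = 0 ∧
    ∀ i : Fin n, ∑ k, ∑ μ, (a k μ * w k (μ.inc i) + pd i (a k μ) * w k μ.up) = 0}
  zero_mem' := by intro a _; simp
  add_mem' := by
    intro v w hv hw a ha
    refine ⟨?_, fun i => ?_⟩
    · simp [mul_add, Finset.sum_add_distrib, (hv a ha).1, (hw a ha).1]
    · have := congrArg₂ (· + ·) ((hv a ha).2 i) ((hw a ha).2 i)
      simp only [Finset.sum_add_distrib, add_zero] at this
      simp only [Pi.add_apply, mul_add, Finset.sum_add_distrib]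
      rw [← this]; ring
  smul_mem' := by
    intro c w hw a ha
    refine ⟨?_, fun i => ?_⟩
    · simp [mul_left_comm _ c, ← Finset.mul_sum, (hw a ha).1]
    · have := congrArg (c * ·) ((hw a ha).2 i)
      simp only [mul_zero] at this
      rw [← this]
      simp [Finset.mul_sum, mul_add, mul_left_comm _ c]

/-- Involutive systems. The prolongation brings no new equation of order `q` (that is,
`R_{q+1} → R_q` is onto), and, after a linear change of the independent variables with constant
coefficients, `g_{q+1}` has the dimension `∑ i α^i_q` found by prolonging each solved equation
with respect to its multiplicative variables only. Since the character
`α^i_q = dim g^{(i-1)} - dim g^{(i)}` counts the parametric jets of order `q` and class `i`, with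
`g^{(i)}` the space `symbolClass R A i`, this number is `dim g^{(0)} + ⋯ + dim g^{(n-1)}`. -/
def IsInvolutive (R : Submodule K (Jet K n m q)) : Prop :=
  (prolong R).map jetProj = R ∧
  ∃ A : Matrix (Fin n) (Fin n) K, IsUnit A ∧ (∀ i j l, pd (n := n) l (A i j) = 0) ∧
    Module.finrank K (symbol (prolong R)) =
      ∑ i ∈ Finset.range n, Module.finrank K (symbolClass R A i)

/-- The row `Φ_a = ∑ a_k^μ d_μ y^k ∈ D y¹ + ⋯ + D yᵐ = Dᵐ` of the linear equation `a`. -/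
def equationRow (a : Jet K n m q) : Fin m → DiffOp n K :=
  fun k => ∑ μ, DiffOp.coef n (a k μ) * DiffOp.monomial μ.1

/-- The differential module of equations `I = DΦ ⊂ Dᵐ` of the system `R`. -/
def equationModule (R : Submodule K (Jet K n m q)) :
    Submodule (DiffOp n K) (Fin m → DiffOp n K) :=
  Submodule.span (DiffOp n K) (equationRow '' (equations R : Set (Jet K n m q)))

/-- The differential module `M = Dᵐ / I` defined by the system `R`. -/
abbrev DModule (R : Submodule K (Jet K n m q)) : Type _ :=
  (Fin m → DiffOp n K) ⧸ equationModule R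

/-- The filtration `M_r ⊂ M`: the `K`-span of the residues of `y^k_μ = d_μ y^k`, `|μ| ≤ r`. -/
def DModule.filtration (R : Submodule K (Jet K n m q)) (r : ℕ) : Submodule K (DModule R) :=
  Submodule.span K {x | ∃ (k : Fin m) (μ : Fin n → ℕ), mlen μ ≤ r ∧
    x = Submodule.Quotient.mk (Pi.single k (DiffOp.monomial μ))}

end System

end

/-! Write `F_r` for the elements of order at most `r` in `Dᵐ`, `B ⊂ F_q` for the equations of the
system and `ξ_j` for the operators given by the rows of the constant matrix `A`; they commute.

Contraction with `ξ_i` maps `g_{q+1}^{(i)}` into `g_q^{(i)}` with kernel `g_{q+1}^{(i+1)}`, so the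
dimension condition says that all these contractions are onto (`map_contract_eq`). Together with the
surjectivity of `R_{q+1} → R_q`, this dualizes to a statement about equations
(`isQuasiRegular_rows`): `B + ∑_k ξ_k B` meets `F_q + ∑_{k<j} ξ_k F_q` only in `B + ∑_{k<j} ξ_k B`.
Because the symbols of the `ξ_j` form a regular sequence of linear forms, the property passes to
every prolongation (`IsQuasiRegular.prolong`). Its case `j = 0` is formal integrability, which gives
`dim M_q = dim R_q` (`finrank_filtration`). Its case `j = 1` shows that `ξ_0` raises the order of
every element of `M` of order greater than `q` (`mem_filtration_of_frameOp_smul_mem`).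

The vectors of `M` killed by a `D`-submodule of the inverse system form a `D`-submodule. If only `0`
is killed, finite-dimensional duality makes the restriction to each `M_r` surjective
(`exists_domRestrict_eq`). It remains to find `dim R_q` forms whose `D`-span separates points. A
basis of the dual of `M_q` handles the vectors of order at most `q`. For a vector `x` of higher
order the iterates `ξ_0^j x` keep reaching new orders, where the forms are still free, so the
extensions to `M` can be chosen such that no such `x` has all its iterates killed
(`exists_detecting_functional`). -/

noncomputable section

/-! ### Commuting products and multi-indices. -/

theorem List.prod_ofFn_pow_add_single {A : Type*} [Monoid A] :
    ∀ {n : ℕ} (g : Fin n → A) (_ : ∀ i j, Commute (g i) (g j)) (μ : Fin n → ℕ) (j : Fin n),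
      (List.ofFn fun i => g i ^ (μ + Pi.single j 1 : Fin n → ℕ) i).prod =
        g j * (List.ofFn fun i => g i ^ μ i).prod
  | 0, _, _, _, j => j.elim0
  | n + 1, g, hg, μ, j => by
    rw [List.ofFn_succ, List.ofFn_succ, List.prod_cons, List.prod_cons]
    induction j using Fin.cases with
    | zero =>
      simp [pow_succ', mul_assoc]
    | succ j =>
      have h := List.prod_ofFn_pow_add_single (fun i : Fin n => g i.succ)
        (fun i j => hg _ _) (fun i => μ i.succ) j
      have e : (fun i : Fin n => g i.succ ^ (μ + Pi.single j.succ 1 : Fin (n + 1) → ℕ) i.succ) =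
          fun i : Fin n => g i.succ ^ ((fun i : Fin n => μ i.succ) + Pi.single j 1 : Fin n → ℕ) i := by
        funext i
        by_cases hij : i = j
        · subst hij; simp
        · have : i.succ ≠ j.succ := fun h => hij (Fin.succ_injective _ h)
          simp [hij]
      rw [e, h, ← mul_assoc, ← mul_assoc]
      congr 1
      have e0 : (μ + Pi.single j.succ 1 : Fin (n + 1) → ℕ) 0 = μ 0 := by simp
      rw [e0]
      exact ((hg 0 j.succ).pow_left _).eq

/-- Induction on multi-indices by increasing one component. -/
theorem multiIndex_induction {n : ℕ} {P : (Fin n → ℕ) → Prop} (h0 : P 0)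
    (hs : ∀ μ i, P μ → P (μ + Pi.single i 1)) (μ : Fin n → ℕ) : P μ := by
  induction hk : mlen μ generalizing μ with
  | zero =>
    have : μ = 0 := by
      funext i
      simpa [mlen] using (Finset.sum_eq_zero_iff.mp hk) i (Finset.mem_univ i)
    exact this ▸ h0
  | succ k ih =>
    obtain ⟨i, hi⟩ : ∃ i, μ i ≠ 0 := by
      by_contra! h
      simp [mlen, h] at hk
    have e : μ = (μ - Pi.single i 1) + Pi.single i 1 := by
      funext j
      by_cases hj : j = i
      · subst hj; simp; omega
      · simp [hj]
    rw [e]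
    refine hs _ _ (ih _ ?_)
    have := mlen_add_single (μ - Pi.single i 1) i
    rw [← e] at this
    omega

theorem exists_eq_add_single {n : ℕ} {μ : Fin n → ℕ} {r : ℕ} (h : mlen μ = r + 1) :
    ∃ ν i, mlen ν = r ∧ μ = ν + Pi.single i 1 := by
  revert h
  induction μ using multiIndex_induction with
  | h0 => intro h; simp [mlen] at h
  | hs ν i _ => exact fun h => ⟨ν, i, by rw [mlen_add_single] at h; omega, rfl⟩

/-! ### The monomial basis of `D` and the filtration by order. -/

namespace DiffOp

variable {n : ℕ} {K : Type*} [Field K] [PartialDifferentialField n K]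

theorem monomial_zero : monomial (n := n) (K := K) 0 = 1 := by
  simp [monomial]

theorem d_mul_monomial (i : Fin n) (μ : Fin n → ℕ) :
    d K i * monomial μ = monomial (μ + Pi.single i 1) :=
  (List.prod_ofFn_pow_add_single (fun i => d K i) (fun i j => d_mul_d i j) μ i).symm

theorem d_mul_smul (i : Fin n) (a : K) (P : DiffOp n K) :
    d K i * a • P = a • (d K i * P) + pd i a • P :=
  d_smul_smul i a P

/-- An induction principle: `D` is generated as a ring by `K` and the `dᵢ`. -/
theorem induction_on {p : DiffOp n K → Prop} (P : DiffOp n K) (hc : ∀ a, p (coef n a))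
    (hd : ∀ i, p (d K i)) (hadd : ∀ P Q, p P → p Q → p (P + Q))
    (hmul : ∀ P Q, p P → p Q → p (P * Q)) : p P := by
  obtain ⟨x, rfl⟩ := RingQuot.mkRingHom_surjective (Rel n K) P
  change p (mk n K x)
  induction x using FreeAlgebra.induction with
  | grade0 z =>
    rw [eq_intCast, map_intCast, ← map_intCast (coef (K := K) n) z]
    exact hc _
  | grade1 x =>
    rcases x with a | i
    · exact hc a
    · exact hd i
  | mul a b ha hb => rw [map_mul]; exact hmul _ _ ha hb
  | add a b ha hb => rw [map_add]; exact hadd _ _ ha hb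

variable (n K) in
/-- The action of `dᵢ` on symbols of operators, `dᵢ (a X^μ) = a X^(μ+1ᵢ) + (∂ᵢ a) X^μ`. -/
def symbolAct (i : Fin n) : AddMonoid.End ((Fin n → ℕ) →₀ K) :=
  Finsupp.mapDomain.addMonoidHom (· + Pi.single i 1) +
    Finsupp.mapRange.addMonoidHom (pd (n := n) (K := K) i).toLinearMap.toAddMonoidHom

theorem symbolAct_single (i : Fin n) (μ : Fin n → ℕ) (a : K) :
    symbolAct n K i (Finsupp.single μ a) =
      Finsupp.single (μ + Pi.single i 1) a + Finsupp.single μ (pd i a) := by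
  change Finsupp.mapDomain (· + Pi.single i 1) (Finsupp.single μ a) +
    Finsupp.mapRange (fun x : K => pd (n := n) i x) (map_zero _) (Finsupp.single μ a) = _
  rw [Finsupp.mapDomain_single, Finsupp.mapRange_single]

theorem symbolAct_comm (i j : Fin n) :
    symbolAct n K i * symbolAct n K j = symbolAct n K j * symbolAct n K i := by
  refine Finsupp.addHom_ext fun μ a => ?_
  change symbolAct n K i (symbolAct n K j (Finsupp.single μ a)) =
    symbolAct n K j (symbolAct n K i (Finsupp.single μ a))
  simp only [symbolAct_single, map_add,
    PartialDifferentialField.der_comm i j a, add_right_comm μ (Pi.single i 1)]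
  abel

theorem symbolAct_leibniz (i : Fin n) (a : K) :
    symbolAct n K i * Module.toAddMonoidEnd K ((Fin n → ℕ) →₀ K) a =
      Module.toAddMonoidEnd K ((Fin n → ℕ) →₀ K) a * symbolAct n K i +
        Module.toAddMonoidEnd K ((Fin n → ℕ) →₀ K) (pd i a) := by
  refine Finsupp.addHom_ext fun μ b => ?_
  change symbolAct n K i (a • Finsupp.single μ b) =
    a • symbolAct n K i (Finsupp.single μ b) + pd i a • Finsupp.single μ b
  simp only [symbolAct_single, Finsupp.smul_single, smul_add, smul_eq_mul,
    Derivation.leibniz, Finsupp.single_add, mul_comm b]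
  abel

variable (n K) in
/-- The action of `D` on symbols of operators. -/
def symbolRep : DiffOp n K →+* AddMonoid.End ((Fin n → ℕ) →₀ K) :=
  lift (n := n) (K := K) (B := AddMonoid.End ((Fin n → ℕ) →₀ K))
    (Module.toAddMonoidEnd K ((Fin n → ℕ) →₀ K)) (symbolAct n K) symbolAct_comm
    symbolAct_leibniz

theorem symbolRep_coef (a : K) :
    symbolRep n K (coef n a) = Module.toAddMonoidEnd K ((Fin n → ℕ) →₀ K) a :=
  lift_coef _ _ _ _ a

theorem symbolRep_d (i : Fin n) : symbolRep n K (d K i) = symbolAct n K i :=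
  lift_d _ _ _ _ i

variable (n K) in
/-- The total symbol `∑ a_μ d^μ ↦ ∑ a_μ X^μ`. -/
def totalSymbol : DiffOp n K →ₗ[K] ((Fin n → ℕ) →₀ K) where
  toFun P := symbolRep n K P (Finsupp.single 0 1)
  map_add' P Q := by rw [map_add]; rfl
  map_smul' a P := by
    rw [smul_def, map_mul, symbolRep_coef]; rfl

theorem totalSymbol_monomial (μ : Fin n → ℕ) :
    totalSymbol n K (monomial μ) = Finsupp.single μ 1 := by
  induction μ using multiIndex_induction with
  | h0 => rw [monomial_zero]; change symbolRep n K 1 _ = _; rw [map_one]; rfl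
  | hs μ i ih =>
    rw [← d_mul_monomial]
    change symbolRep n K (d K i * monomial μ) (Finsupp.single 0 1) = _
    rw [map_mul, AddMonoid.End.coe_mul, Function.comp_apply]
    change symbolRep n K (d K i) (totalSymbol n K (monomial μ)) = _
    rw [ih, symbolRep_d, symbolAct_single]
    simp

/-- A ring given by generators and relations might collapse. It does not, because `D` acts on
symbols and there `d^μ` sends `1` to `X^μ`. -/
theorem linearIndependent_monomial : LinearIndependent K (monomial (n := n) (K := K)) := by
  refine LinearIndependent.of_comp (totalSymbol n K) ?_
  have : (totalSymbol n K ∘ monomial) = (Finsupp.basisSingleOne (R := K)) := by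
    funext μ
    simp [totalSymbol_monomial]
  rw [this]
  exact Module.Basis.linearIndependent _

theorem span_monomial : Submodule.span K (Set.range (monomial (n := n) (K := K))) = ⊤ := by
  set S := Submodule.span K (Set.range (monomial (n := n) (K := K)))
  have key : ∀ P : DiffOp n K, ∀ Q ∈ S, P * Q ∈ S := by
    intro P
    induction P using induction_on with
    | hc a => intro Q hQ; exact S.smul_mem a hQ
    | hd i =>
      intro Q hQ
      induction hQ using Submodule.span_induction with
      | mem Q hQ =>
        obtain ⟨μ, rfl⟩ := hQ
        rw [d_mul_monomial]
        exact Submodule.subset_span ⟨_, rfl⟩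
      | zero => simp
      | add x y _ _ hx hy => rw [mul_add]; exact S.add_mem hx hy
      | smul a x hx' hx =>
        rw [d_mul_smul]
        exact S.add_mem (S.smul_mem _ hx) (S.smul_mem _ hx')
    | hadd P Q hP hQ => intro x hx; rw [add_mul]; exact S.add_mem (hP x hx) (hQ x hx)
    | hmul P Q hP hQ => intro x hx; rw [mul_assoc]; exact hP _ (hQ x hx)
  refine eq_top_iff.mpr fun P _ => ?_
  rw [← mul_one P]
  exact key P 1 (Submodule.subset_span ⟨0, monomial_zero⟩)

variable (n K) in
/-- The monomials `d^μ` form a basis of `D` over `K`. -/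
def monomialBasis : Module.Basis (Fin n → ℕ) K (DiffOp n K) :=
  Module.Basis.mk linearIndependent_monomial span_monomial.ge

@[simp] theorem monomialBasis_apply (μ : Fin n → ℕ) :
    monomialBasis n K μ = monomial μ := by
  simp [monomialBasis]

variable (n K) in
/-- The operators of order at most `r`. -/
def orderLE (r : ℕ) : Submodule K (DiffOp n K) :=
  Submodule.span K {P | ∃ μ : Fin n → ℕ, mlen μ ≤ r ∧ P = monomial μ}

theorem monomial_mem_orderLE {μ : Fin n → ℕ} {r : ℕ} (h : mlen μ ≤ r) :
    monomial μ ∈ orderLE n K r := Submodule.subset_span ⟨μ, h, rfl⟩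

theorem orderLE_mono {r s : ℕ} (h : r ≤ s) : orderLE n K r ≤ orderLE n K s :=
  Submodule.span_mono fun _ ⟨μ, hμ, e⟩ => ⟨μ, hμ.trans h, e⟩

theorem d_mul_mem_orderLE (i : Fin n) {r : ℕ} {P : DiffOp n K} (hP : P ∈ orderLE n K r) :
    d K i * P ∈ orderLE n K (r + 1) := by
  induction hP using Submodule.span_induction with
  | mem Q hQ =>
    obtain ⟨μ, hμ, rfl⟩ := hQ
    rw [d_mul_monomial]
    exact monomial_mem_orderLE (by rw [mlen_add_single]; omega)
  | zero => simp
  | add x y _ _ hx hy => rw [mul_add]; exact Submodule.add_mem _ hx hy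
  | smul a x hx' hx =>
    rw [d_mul_smul]
    exact Submodule.add_mem _ (Submodule.smul_mem _ _ hx)
      (Submodule.smul_mem _ _ (orderLE_mono (Nat.le_succ r) hx'))

theorem exists_mem_orderLE (P : DiffOp n K) : ∃ r, P ∈ orderLE n K r := by
  have hP : P ∈ Submodule.span K (Set.range (monomial (n := n) (K := K))) := by
    rw [span_monomial]; trivial
  induction hP using Submodule.span_induction with
  | mem Q hQ =>
    obtain ⟨μ, rfl⟩ := hQ
    exact ⟨_, monomial_mem_orderLE le_rfl⟩
  | zero => exact ⟨0, Submodule.zero_mem _⟩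
  | add x y _ _ hx hy =>
    obtain ⟨r, hr⟩ := hx
    obtain ⟨s, hs⟩ := hy
    exact ⟨max r s, Submodule.add_mem _ (orderLE_mono (le_max_left _ _) hr)
      (orderLE_mono (le_max_right _ _) hs)⟩
  | smul a x _ hx =>
    obtain ⟨r, hr⟩ := hx
    exact ⟨r, Submodule.smul_mem _ _ hr⟩

end DiffOp

/-! ### Prolongation and quasi-regularity in a filtered module. -/

section FrameSum

variable {A F : Type*} [Ring A] [AddCommGroup F] [Module A F]

/-- The additive subgroup `G + ξ₀ G + ⋯ + ξ_{j-1} G`. -/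
def frameSum (ξ : ℕ → A) (G : AddSubgroup F) : ℕ → AddSubgroup F
  | 0 => G
  | j + 1 => frameSum ξ G j ⊔ G.map (DistribSMul.toAddMonoidHom F (ξ j))

variable {ξ : ℕ → A} {G H : AddSubgroup F}

theorem mem_frameSum_succ {j : ℕ} {x : F} :
    x ∈ frameSum ξ G (j + 1) ↔ ∃ y ∈ frameSum ξ G j, ∃ z ∈ G, x = y + ξ j • z := by
  simp only [frameSum, AddSubgroup.mem_sup, AddSubgroup.mem_map]
  constructor
  · rintro ⟨y, hy, _, ⟨z, hz, rfl⟩, rfl⟩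
    exact ⟨y, hy, z, hz, rfl⟩
  · rintro ⟨y, hy, z, hz, rfl⟩
    exact ⟨y, hy, _, ⟨z, hz, rfl⟩, rfl⟩

theorem frameSum_mono_right : Monotone (frameSum ξ G) :=
  monotone_nat_of_le_succ fun _ => le_sup_left

theorem le_frameSum (j : ℕ) : G ≤ frameSum ξ G j :=
  frameSum_mono_right (Nat.zero_le j)

theorem frameSum_mono_left (h : G ≤ H) : ∀ j, frameSum ξ G j ≤ frameSum ξ H j
  | 0 => h
  | j + 1 => sup_le_sup (frameSum_mono_left h j) (AddSubgroup.map_mono h)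

theorem smul_mem_frameSum {j k : ℕ} (hk : k < j) {x : F} (hx : x ∈ G) :
    ξ k • x ∈ frameSum ξ G j :=
  frameSum_mono_right (Nat.succ_le_of_lt hk)
    (mem_frameSum_succ.mpr ⟨0, zero_mem _, x, hx, (zero_add _).symm⟩)

theorem frameSum_induction {p : F → Prop} {j : ℕ} (h0 : ∀ x ∈ G, p x)
    (hs : ∀ k < j, ∀ x ∈ G, p (ξ k • x)) (hadd : ∀ x y, p x → p y → p (x + y)) {x : F}
    (hx : x ∈ frameSum ξ G j) : p x := by
  induction j generalizing x with
  | zero => exact h0 x hx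
  | succ j ih =>
    obtain ⟨y, hy, z, hz, rfl⟩ := mem_frameSum_succ.mp hx
    exact hadd _ _ (ih (fun k hk => hs k (hk.trans (Nat.lt_succ_self j))) hy)
      (hs j (Nat.lt_succ_self j) z hz)

/-- Commutation lets `ξ i` slip past the outer factors `ξ k`, `k < j`, and be absorbed by the inner
group, so the outer indices stay below `j`. -/
theorem smul_frameSum_le (hξ : ∀ i j, ξ i * ξ j = ξ j * ξ i) {i N : ℕ} (hi : i < N) {j : ℕ}
    {x : F} (hx : x ∈ frameSum ξ G j) : ξ i • x ∈ frameSum ξ (frameSum ξ G N) j := by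
  refine frameSum_induction (p := fun x => ξ i • x ∈ _)
    (fun x hx => le_frameSum j (smul_mem_frameSum hi hx)) (fun k hk x hx => ?_)
    (fun x y hx hy => by rw [smul_add]; exact add_mem hx hy) hx
  rw [← mul_smul, hξ, mul_smul]
  exact smul_mem_frameSum hk (smul_mem_frameSum hi hx)

/-- The iterated prolongations `G`, `∑ ξᵢ G`, … of `G` along `ξ₀, …, ξ_{N-1}`. -/
def iterProlong (ξ : ℕ → A) (N : ℕ) (G : AddSubgroup F) : ℕ → AddSubgroup F
  | 0 => G
  | s + 1 => frameSum ξ (iterProlong ξ N G s) N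

/-- `ξ₀, …, ξ_{N-1}` acts as a regular sequence on the graded group of the filtration. -/
def IsSymbolRegular (ξ : ℕ → A) (N : ℕ) (Fr : ℕ → AddSubgroup F) : Prop :=
  ∀ r, ∀ i < N, ∀ x ∈ Fr (r + 1), ξ i • x ∈ frameSum ξ (Fr (r + 1)) i → x ∈ frameSum ξ (Fr r) i

/-- The form of involutivity for a group `B` of equations in the step `G` of a filtration. -/
def IsQuasiRegular (ξ : ℕ → A) (N : ℕ) (G B : AddSubgroup F) : Prop :=
  ∀ j ≤ N, ∀ x ∈ frameSum ξ B N, x ∈ frameSum ξ G j → x ∈ frameSum ξ B j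

/-- Involutivity persists under prolongation. -/
theorem IsQuasiRegular.prolong (hξ : ∀ i j, ξ i * ξ j = ξ j * ξ i) {N : ℕ}
    {G G' B : AddSubgroup F} (hB : frameSum ξ B N ≤ G')
    (hreg : ∀ i < N, ∀ x ∈ G', ξ i • x ∈ frameSum ξ G' i → x ∈ frameSum ξ G i)
    (h : IsQuasiRegular ξ N G B) : IsQuasiRegular ξ N G' (frameSum ξ B N) := by
  intro j hj x hx hxj
  -- Descend from `N` to `j`, removing one frame vector at a time. Regularity puts the coefficient
  -- `z` of `ξ i` in `frameSum ξ G i`, the hypothesis on `B` then puts it in `frameSum ξ B i`, and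
  -- commutation absorbs the factor `ξ i`.
  refine Nat.decreasingInduction' (P := fun i => x ∈ frameSum ξ (frameSum ξ B N) i)
    (fun i hi hji ih => ?_) hj hx
  obtain ⟨y, hy, z, hz, rfl⟩ := mem_frameSum_succ.mp ih
  refine add_mem hy (smul_frameSum_le hξ hi (h i hi.le z hz (hreg i hi z (hB hz) ?_)))
  have := sub_mem (frameSum_mono_right hji hxj) (frameSum_mono_left hB i hy)
  rwa [add_sub_cancel_left] at this

theorem IsQuasiRegular.iterProlong (hξ : ∀ i j, ξ i * ξ j = ξ j * ξ i) {N q : ℕ}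
    {Fr : ℕ → AddSubgroup F} {B : AddSubgroup F} (hB : B ≤ Fr q)
    (hFr : ∀ r, frameSum ξ (Fr r) N ≤ Fr (r + 1)) (hreg : IsSymbolRegular ξ N Fr)
    (h : IsQuasiRegular ξ N (Fr q) B) (s : ℕ) :
    iterProlong ξ N B s ≤ Fr (q + s) ∧ IsQuasiRegular ξ N (Fr (q + s)) (iterProlong ξ N B s) := by
  induction s with
  | zero => exact ⟨hB, h⟩
  | succ s ih =>
    have h1 := (frameSum_mono_left ih.1 N).trans (hFr (q + s))
    exact ⟨h1, ih.2.prolong hξ h1 (hreg (q + s))⟩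

theorem iterProlong_mono (N : ℕ) : Monotone (iterProlong ξ N G) :=
  monotone_nat_of_le_succ fun _ => le_frameSum N

/-- Prolongation brings no new equations of lower order. -/
theorem iterProlong_inf_le {N q : ℕ} {Fr : ℕ → AddSubgroup F} {B : AddSubgroup F}
    (hmono : Monotone Fr)
    (h : ∀ s, IsQuasiRegular ξ N (Fr (q + s)) (iterProlong ξ N B s)) {s t : ℕ} {x : F}
    (hx : x ∈ iterProlong ξ N B (s + t)) (hxs : x ∈ Fr (q + s)) : x ∈ iterProlong ξ N B s := by
  induction t with
  | zero => exact hx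
  -- Quasi-regularity with no frame vector removes one prolongation at a time.
  | succ t ih => exact ih (h (s + t) 0 (Nat.zero_le N) x hx (hmono (by omega) hxs))

end FrameSum

/-! ### Independent linear forms are a regular sequence. -/

section LinearForms

variable {n : ℕ} {K : Type*} [Field K]

/-- The linear forms `∑ A_{jl} X_l`, extended by zero to all `j`. -/
def linForm (A : Matrix (Fin n) (Fin n) K) (j : ℕ) : MvPolynomial (Fin n) K :=
  if h : j < n then ∑ l, MvPolynomial.C (A ⟨j, h⟩ l) * MvPolynomial.X l else 0

theorem linForm_fin (A : Matrix (Fin n) (Fin n) K) (j : Fin n) :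
    linForm A j = ∑ l, MvPolynomial.C (A j l) * MvPolynomial.X l := by
  simp [linForm]

theorem linForm_isHomogeneous (A : Matrix (Fin n) (Fin n) K) (j : ℕ) :
    (linForm A j).IsHomogeneous 1 := by
  unfold linForm
  split_ifs
  · exact MvPolynomial.IsHomogeneous.sum _ _ _ fun l _ => by
      simpa using (MvPolynomial.isHomogeneous_C (Fin n) _).mul (MvPolynomial.isHomogeneous_X K l)
  · exact MvPolynomial.isHomogeneous_zero _ _ _

theorem aeval_linForm (A B : Matrix (Fin n) (Fin n) K) (j : Fin n) :
    MvPolynomial.aeval (fun i : Fin n => linForm A i) (linForm B j) = linForm (B * A) j := by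
  simp only [linForm_fin, map_sum, map_mul, MvPolynomial.aeval_X, MvPolynomial.algHom_C,
    MvPolynomial.algebraMap_eq, Matrix.mul_apply, Finset.mul_sum, Finset.sum_mul, ← mul_assoc]
  exact Finset.sum_comm

theorem linForm_one (j : Fin n) :
    linForm (1 : Matrix (Fin n) (Fin n) K) j = MvPolynomial.X j := by
  rw [linForm_fin, Finset.sum_eq_single j]
  · simp
  · intro l _ h; simp [Matrix.one_apply_ne h.symm]
  · simp

/-- The ideal generated by the first `j` linear forms. -/
def linIdeal (A : Matrix (Fin n) (Fin n) K) (j : ℕ) : Ideal (MvPolynomial (Fin n) K) :=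
  Ideal.span (linForm A '' {k | k < j})

theorem linForm_mem_linIdeal (A : Matrix (Fin n) (Fin n) K) {k j : ℕ} (h : k < j) :
    linForm A k ∈ linIdeal A j := Ideal.subset_span ⟨k, h, rfl⟩

theorem mem_linIdeal_succ {A : Matrix (Fin n) (Fin n) K} {j : ℕ} {p : MvPolynomial (Fin n) K}
    (h : p ∈ linIdeal A (j + 1)) : ∃ u ∈ linIdeal A j, ∃ v, p = u + linForm A j * v := by
  have e : {k | k < j + 1} = insert j {k | k < j} := by ext k; simp; omega
  rw [linIdeal, e, Set.image_insert_eq, Ideal.mem_span_insert'] at h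
  obtain ⟨a, ha⟩ := h
  exact ⟨_, ha, -a, by ring⟩

attribute [local instance] MvPolynomial.gradedAlgebra in
theorem homogeneousComponent_mem_linIdeal {A : Matrix (Fin n) (Fin n) K} {j : ℕ}
    {p : MvPolynomial (Fin n) K} (h : p ∈ linIdeal A j) (r : ℕ) :
    MvPolynomial.homogeneousComponent r p ∈ linIdeal A j := by
  refine MvPolynomial.homogeneousComponent_mem_of_mem ?_ h r
  refine Ideal.homogeneous_span _ _ ?_
  rintro _ ⟨k, _, rfl⟩
  exact ⟨1, linForm_isHomogeneous A k⟩

attribute [local instance] MvPolynomial.gradedAlgebra in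
theorem homogeneousComponent_linForm_mul (A : Matrix (Fin n) (Fin n) K) (j r : ℕ)
    (p : MvPolynomial (Fin n) K) :
    MvPolynomial.homogeneousComponent (r + 1) (linForm A j * p) =
      linForm A j * MvPolynomial.homogeneousComponent r p := by
  have := DirectSum.coe_decompose_mul_add_of_left_mem
    (MvPolynomial.homogeneousSubmodule (Fin n) K) (j := r) (b := p) (linForm_isHomogeneous A j)
  have e (f : MvPolynomial (Fin n) K) (i : ℕ) :
      (DirectSum.decompose (MvPolynomial.homogeneousSubmodule (Fin n) K) f i :
        MvPolynomial (Fin n) K) = MvPolynomial.homogeneousComponent i f :=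
    MvPolynomial.decomposition.decompose'_apply f i
  rwa [add_comm 1 r, e, e] at this

theorem aeval_linForm_mem_span_X {A B : Matrix (Fin n) (Fin n) K} (hAB : A * B = 1) {i : ℕ}
    (hi : i ≤ n) {p : MvPolynomial (Fin n) K} (hp : p ∈ linIdeal A i) :
    MvPolynomial.aeval (fun i : Fin n => linForm B i) p ∈
      Ideal.span (MvPolynomial.X (R := K) '' {k : Fin n | k.1 < i}) := by
  induction hp using Submodule.span_induction with
  | mem x hx =>
    obtain ⟨k, hk, rfl⟩ := hx
    have hk : k < i := hk
    have := aeval_linForm B A ⟨k, hk.trans_le hi⟩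
    rw [hAB, linForm_one] at this
    rw [show linForm A k = linForm A (⟨k, hk.trans_le hi⟩ : Fin n) from rfl, this]
    exact Ideal.subset_span ⟨_, hk, rfl⟩
  | zero => rw [map_zero]; exact zero_mem _
  | add x y _ _ hx hy => rw [map_add]; exact add_mem hx hy
  | smul a x _ hx => rw [smul_eq_mul, map_mul]; exact Ideal.mul_mem_left _ _ hx

theorem aeval_linForm_mem_linIdeal (A : Matrix (Fin n) (Fin n) K) {i : ℕ}
    {p : MvPolynomial (Fin n) K}
    (hp : p ∈ Ideal.span (MvPolynomial.X (R := K) '' {k : Fin n | k.1 < i})) :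
    MvPolynomial.aeval (fun i : Fin n => linForm A i) p ∈ linIdeal A i := by
  induction hp using Submodule.span_induction with
  | mem x hx =>
    obtain ⟨k, hk, rfl⟩ := hx
    rw [MvPolynomial.aeval_X]
    exact linForm_mem_linIdeal A hk
  | zero => rw [map_zero]; exact zero_mem _
  | add x y _ _ hx hy => rw [map_add]; exact add_mem hx hy
  | smul a x _ hx => rw [smul_eq_mul, map_mul]; exact Ideal.mul_mem_left _ _ hx

/-- The ideal is monomial, so membership is read off the support. Multiplication by `X i` changes
only the exponent of a variable that is not among the generators. -/
theorem mem_span_X_of_X_mul_mem {i : Fin n} {p : MvPolynomial (Fin n) K}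
    (h : MvPolynomial.X i * p ∈
      Ideal.span (MvPolynomial.X (R := K) '' {k : Fin n | k.1 < i})) :
    p ∈ Ideal.span (MvPolynomial.X (R := K) '' {k : Fin n | k.1 < i}) := by
  rw [MvPolynomial.mem_ideal_span_X_image] at h ⊢
  intro d hd
  obtain ⟨k, hk, hk'⟩ := h (Finsupp.single i 1 + d) (by
    rw [MvPolynomial.mem_support_iff, MvPolynomial.coeff_X_mul]
    exact MvPolynomial.mem_support_iff.mp hd)
  refine ⟨k, hk, ?_⟩
  have : i ≠ k := by
    rintro rfl; exact lt_irrefl i.1 hk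
  simpa [Finsupp.single_apply, this] using hk'

theorem aeval_linForm_aeval_linForm {A B : Matrix (Fin n) (Fin n) K} (hBA : B * A = 1)
    (p : MvPolynomial (Fin n) K) :
    MvPolynomial.aeval (fun i : Fin n => linForm A i)
      (MvPolynomial.aeval (fun i : Fin n => linForm B i) p) = p := by
  induction p using MvPolynomial.induction_on with
  | C a => rw [MvPolynomial.algHom_C, MvPolynomial.algebraMap_eq, MvPolynomial.algHom_C,
      MvPolynomial.algebraMap_eq]
  | add p q hp hq => rw [map_add, map_add, hp, hq]
  | mul_X p i hp => rw [map_mul, map_mul, hp, MvPolynomial.aeval_X, aeval_linForm, hBA, linForm_one]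

/-- The linear forms of an invertible matrix are a regular sequence. -/
theorem mem_linIdeal_of_linForm_mul_mem {A : Matrix (Fin n) (Fin n) K} (hA : IsUnit A)
    {i : Fin n} {p : MvPolynomial (Fin n) K} (h : linForm A i * p ∈ linIdeal A i) :
    p ∈ linIdeal A i := by
  obtain ⟨B, hAB, hBA⟩ := isUnit_iff_exists.mp hA
  -- Substituting the forms of the inverse matrix turns the first forms into coordinates.
  have h1 := aeval_linForm_mem_span_X hAB i.2.le h
  rw [map_mul, aeval_linForm, hAB, linForm_one] at h1
  have h2 := aeval_linForm_mem_linIdeal A (mem_span_X_of_X_mul_mem h1)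
  rwa [aeval_linForm_aeval_linForm hBA] at h2

end LinearForms

/-! ### Symbols of operators, and regularity of the frame on `Dᵐ`. -/

namespace DiffOp

variable {n : ℕ} {K : Type*} [Field K] [PartialDifferentialField n K]

variable (n K) in
/-- The total symbol as a polynomial. -/
def symbolPoly : DiffOp n K →ₗ[K] MvPolynomial (Fin n) K :=
  (monomialBasis n K).constr K
    fun μ => MvPolynomial.monomial (Finsupp.equivFunOnFinite.symm μ) 1

theorem symbolPoly_monomial (μ : Fin n → ℕ) :
    symbolPoly n K (monomial μ) =
      MvPolynomial.monomial (Finsupp.equivFunOnFinite.symm μ) 1 := by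
  rw [← monomialBasis_apply, symbolPoly, Module.Basis.constr_basis]

theorem degree_equivFunOnFinite_symm (μ : Fin n → ℕ) :
    (Finsupp.equivFunOnFinite.symm μ).degree = mlen μ := by
  rw [Finsupp.degree_eq_sum]; rfl

variable (n K) in
/-- The part of degree `r` of the symbol. -/
def topSymbol (r : ℕ) : DiffOp n K →ₗ[K] MvPolynomial (Fin n) K :=
  MvPolynomial.homogeneousComponent r ∘ₗ symbolPoly n K

theorem topSymbol_monomial (r : ℕ) (μ : Fin n → ℕ) :
    topSymbol n K r (monomial μ) = if mlen μ = r then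
      MvPolynomial.monomial (Finsupp.equivFunOnFinite.symm μ) 1 else 0 := by
  rw [topSymbol, LinearMap.comp_apply, symbolPoly_monomial]
  rw [MvPolynomial.homogeneousComponent_of_mem
    (MvPolynomial.isHomogeneous_monomial _ (degree_equivFunOnFinite_symm μ))]
  simp only [eq_comm]

theorem topSymbol_eq_zero {r s : ℕ} (h : s < r) {P : DiffOp n K} (hP : P ∈ orderLE n K s) :
    topSymbol n K r P = 0 := by
  have : orderLE n K s ≤ LinearMap.ker (topSymbol n K r) := by
    refine Submodule.span_le.mpr ?_
    rintro _ ⟨μ, hμ, rfl⟩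
    simp only [SetLike.mem_coe, LinearMap.mem_ker, topSymbol_monomial]
    rw [if_neg (by omega)]
  exact this hP

theorem topSymbol_d_mul (i : Fin n) {r : ℕ} {P : DiffOp n K} (hP : P ∈ orderLE n K r) :
    topSymbol n K (r + 1) (d K i * P) = MvPolynomial.X i * topSymbol n K r P := by
  induction hP using Submodule.span_induction with
  | mem Q hQ =>
    obtain ⟨μ, hμ, rfl⟩ := hQ
    rw [d_mul_monomial, topSymbol_monomial, topSymbol_monomial, mlen_add_single]
    simp only [Nat.add_right_cancel_iff]
    split_ifs with h
    · rw [MvPolynomial.X, MvPolynomial.monomial_mul, one_mul]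
      have e : Finsupp.equivFunOnFinite.symm (μ + Pi.single i 1) =
          Finsupp.single i 1 + Finsupp.equivFunOnFinite.symm μ := by
        ext j
        by_cases hj : j = i
        · subst hj; simp [add_comm]
        · simp [hj]
      rw [e]
    · rw [mul_zero]
  | zero => simp
  | add x y _ _ hx hy => rw [mul_add, map_add, hx, hy, map_add, mul_add]
  | smul a x hx' hx =>
    rw [d_mul_smul, map_add, map_smul, map_smul, map_smul, hx,
      topSymbol_eq_zero (Nat.lt_succ_self r) hx', smul_zero, add_zero, mul_smul_comm]

theorem coeff_symbolPoly (P : DiffOp n K) (μ : Fin n → ℕ) :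
    (symbolPoly n K P).coeff (Finsupp.equivFunOnFinite.symm μ) =
      (monomialBasis n K).repr P μ := by
  have : MvPolynomial.lcoeff K (Finsupp.equivFunOnFinite.symm μ) ∘ₗ symbolPoly n K =
      Finsupp.lapply μ ∘ₗ (monomialBasis n K).repr.toLinearMap := by
    refine (monomialBasis n K).ext fun ν => ?_
    simp only [LinearMap.comp_apply, monomialBasis_apply, symbolPoly_monomial]
    rw [← monomialBasis_apply, LinearEquiv.coe_coe, Module.Basis.repr_self]
    simp [MvPolynomial.coeff_monomial, Finsupp.single_apply]
  exact LinearMap.congr_fun this P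

theorem orderLE_eq (r : ℕ) :
    orderLE n K r = Submodule.span K (monomialBasis n K '' {μ | mlen μ ≤ r}) := by
  unfold orderLE
  congr 1
  ext P
  simp [eq_comm]

theorem mem_orderLE_of_topSymbol_eq_zero {r : ℕ} {P : DiffOp n K}
    (hP : P ∈ orderLE n K (r + 1)) (h : topSymbol n K (r + 1) P = 0) : P ∈ orderLE n K r := by
  rw [orderLE_eq, Module.Basis.mem_span_image] at hP ⊢
  intro μ hμ
  have h1 : mlen μ ≤ r + 1 := hP hμ
  have h2 : mlen μ ≠ r + 1 := by
    intro h2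
    have h3 := congrArg (MvPolynomial.coeff (Finsupp.equivFunOnFinite.symm μ)) h
    rw [topSymbol, LinearMap.comp_apply, MvPolynomial.coeff_homogeneousComponent,
      if_pos (by rw [degree_equivFunOnFinite_symm, h2]), coeff_symbolPoly] at h3
    exact Finsupp.mem_support_iff.mp hμ h3
  rw [Set.mem_ofPred_eq]
  omega

theorem exists_topSymbol_eq {r : ℕ} {p : MvPolynomial (Fin n) K} (hp : p.IsHomogeneous r) :
    ∃ P ∈ orderLE n K r, topSymbol n K r P = p := by
  have hd : ∀ e ∈ p.support, mlen (e : Fin n → ℕ) = r := fun e he => by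
    rw [← degree_equivFunOnFinite_symm, Finsupp.degree_eq_weight_one]
    rw [Finsupp.equivFunOnFinite_symm_coe]
    exact hp (MvPolynomial.mem_support_iff.mp he)
  refine ⟨∑ e ∈ p.support, p.coeff e • monomial e, Submodule.sum_mem _ fun e he =>
    Submodule.smul_mem _ _ (monomial_mem_orderLE (hd e he).le), ?_⟩
  conv_rhs => rw [p.as_sum]
  rw [map_sum]
  refine Finset.sum_congr rfl fun e he => ?_
  rw [map_smul, topSymbol_monomial, if_pos (hd e he), MvPolynomial.smul_monomial, smul_eq_mul,
    mul_one, Finsupp.equivFunOnFinite_symm_coe]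

/-- The operators `ξ_j = ∑ A_{jl} d_l`, extended by zero to all `j`. -/
def frameOp (A : Matrix (Fin n) (Fin n) K) (j : ℕ) : DiffOp n K :=
  if h : j < n then ∑ l, coef n (A ⟨j, h⟩ l) * d K l else 0

theorem frameOp_fin (A : Matrix (Fin n) (Fin n) K) (j : Fin n) :
    frameOp A j = ∑ l, A j l • d K l := by
  simp [frameOp, smul_def]

/-- The derivations `∑ A_{jl} ∂_l` of `K`. -/
def frameDer (A : Matrix (Fin n) (Fin n) K) (j : ℕ) (a : K) : K :=
  if h : j < n then ∑ l, A ⟨j, h⟩ l * pd l a else 0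

theorem frameOp_smul {F : Type*} [AddCommGroup F] [Module K F] [Module (DiffOp n K) F]
    [IsScalarTower K (DiffOp n K) F] (A : Matrix (Fin n) (Fin n) K) (j : ℕ) (x : F) :
    frameOp A j • x = if h : j < n then ∑ l, A ⟨j, h⟩ l • d K l • x else 0 := by
  unfold frameOp
  split_ifs with h
  · simp only [Finset.sum_smul, mul_smul, coef_smul]
  · exact zero_smul _ _

theorem frameOp_smul_smul {F : Type*} [AddCommGroup F] [Module K F] [Module (DiffOp n K) F]
    [IsScalarTower K (DiffOp n K) F] (A : Matrix (Fin n) (Fin n) K) (j : ℕ) (a : K) (x : F) :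
    frameOp A j • a • x = a • frameOp A j • x + frameDer A j a • x := by
  rw [frameOp_smul, frameOp_smul, frameDer]
  split_ifs with h
  · simp only [d_smul_smul, smul_add, Finset.sum_add_distrib, Finset.smul_sum, Finset.sum_smul,
      mul_smul, smul_comm a]
  · simp

/-- This is where constant coefficients matter: no derivative of an entry of `A` appears when the
`d_k` move past them. -/
theorem frameOp_comm {A : Matrix (Fin n) (Fin n) K}
    (hA : ∀ i j l, pd (n := n) l (A i j) = 0) (i j : ℕ) :
    frameOp A i * frameOp A j = frameOp A j * frameOp A i := by
  by_cases hi : i < n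
  swap
  · simp [frameOp, hi]
  by_cases hj : j < n
  swap
  · simp [frameOp, hj]
  rw [frameOp, frameOp, dif_pos hi, dif_pos hj, Finset.sum_mul_sum, Finset.sum_mul_sum,
    Finset.sum_comm]
  refine Finset.sum_congr rfl fun k _ => Finset.sum_congr rfl fun l _ => ?_
  have e (P Q : K) (hQ : ∀ i : Fin n, pd i Q = 0) (k l : Fin n) :
      coef n P * d K k * (coef n Q * d K l) = coef n (P * Q) * (d K k * d K l) := by
    rw [mul_assoc, ← mul_assoc (d K k), d_mul_coef, hQ, map_zero, add_zero, map_mul]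
    simp only [mul_assoc]
  rw [e _ _ (fun i => hA _ _ i), e _ _ (fun i => hA _ _ i), d_mul_d, mul_comm (A _ _)]

theorem topSymbol_frameOp_mul (A : Matrix (Fin n) (Fin n) K) (j : ℕ) {r : ℕ} {P : DiffOp n K}
    (hP : P ∈ orderLE n K r) :
    topSymbol n K (r + 1) (frameOp A j * P) = linForm A j * topSymbol n K r P := by
  rw [← smul_eq_mul, frameOp_smul, linForm]
  split_ifs with h
  · simp only [map_sum, map_smul, smul_eq_mul, topSymbol_d_mul _ hP, Finset.sum_mul,
      MvPolynomial.smul_eq_C_mul, mul_assoc]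
  · simp

variable (n K) in
/-- The elements of order at most `r` in the free module `Dᵐ`. -/
def freeFil (m r : ℕ) : Submodule K (Fin m → DiffOp n K) :=
  Submodule.pi Set.univ fun _ => orderLE n K r

theorem mem_freeFil {m r : ℕ} {x : Fin m → DiffOp n K} :
    x ∈ freeFil n K m r ↔ ∀ k, x k ∈ orderLE n K r := by
  simp [freeFil, Submodule.mem_pi]

theorem freeFil_mono (m : ℕ) : Monotone (freeFil n K m) := fun _ _ h _ hx =>
  mem_freeFil.mpr fun k => orderLE_mono h (mem_freeFil.mp hx k)

theorem d_smul_mem_freeFil {m r : ℕ} (i : Fin n) {x : Fin m → DiffOp n K}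
    (hx : x ∈ freeFil n K m r) : d K i • x ∈ freeFil n K m (r + 1) :=
  mem_freeFil.mpr fun k => d_mul_mem_orderLE i (mem_freeFil.mp hx k)

theorem frameOp_smul_mem_freeFil {m r : ℕ} (A : Matrix (Fin n) (Fin n) K) (j : ℕ)
    {x : Fin m → DiffOp n K} (hx : x ∈ freeFil n K m r) :
    frameOp A j • x ∈ freeFil n K m (r + 1) := by
  rw [frameOp_smul]
  split_ifs
  · exact Submodule.sum_mem _ fun l _ => Submodule.smul_mem _ _ (d_smul_mem_freeFil l hx)
  · exact Submodule.zero_mem _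

theorem frameSum_freeFil_le {m r : ℕ} (A : Matrix (Fin n) (Fin n) K) (j : ℕ) :
    frameSum (frameOp A) (freeFil n K m r).toAddSubgroup j ≤
      (freeFil n K m (r + 1)).toAddSubgroup := fun _ hx =>
  frameSum_induction (p := (· ∈ (freeFil n K m (r + 1)).toAddSubgroup))
    (fun _ hx => freeFil_mono m (Nat.le_succ r) hx)
    (fun k _ _ hx => frameOp_smul_mem_freeFil A k hx) (fun _ _ hx hy => add_mem hx hy) hx

theorem topSymbol_mem_of_mem_frameSum {m r : ℕ} {A : Matrix (Fin n) (Fin n) K} {j : ℕ}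
    {x : Fin m → DiffOp n K}
    (hx : x ∈ frameSum (frameOp A) (freeFil n K m r).toAddSubgroup j) (k : Fin m) :
    topSymbol n K (r + 1) (x k) ∈ linIdeal A j := by
  refine frameSum_induction
    (p := fun x : Fin m → DiffOp n K => topSymbol n K (r + 1) (x k) ∈ linIdeal A j)
    (fun x hx => ?_) (fun i hi x hx => ?_) (fun x y hx hy => ?_) hx
  · rw [topSymbol_eq_zero (Nat.lt_succ_self r) (mem_freeFil.mp hx k)]
    exact zero_mem _
  · rw [Pi.smul_apply, smul_eq_mul, topSymbol_frameOp_mul A i (mem_freeFil.mp hx k)]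
    exact Ideal.mul_mem_right _ _ (linForm_mem_linIdeal A hi)
  · rw [Pi.add_apply, map_add]
    exact add_mem hx hy

/-- The coefficient of the last linear form may be replaced by its component of degree `r`, which is
the symbol of an operator `y` of order `r`. Subtracting `ξ_j y` leaves a symbol in the ideal of the
earlier forms. When no form is left the symbol is zero and the order drops. -/
theorem mem_frameSum_of_topSymbol_mem {m r : ℕ} {A : Matrix (Fin n) (Fin n) K} {j : ℕ}
    {x : Fin m → DiffOp n K} (hx : x ∈ freeFil n K m (r + 1))
    (h : ∀ k, topSymbol n K (r + 1) (x k) ∈ linIdeal A j) :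
    x ∈ frameSum (frameOp A) (freeFil n K m r).toAddSubgroup j := by
  induction j generalizing x with
  | zero =>
    refine mem_freeFil.mpr fun k => mem_orderLE_of_topSymbol_eq_zero (mem_freeFil.mp hx k) ?_
    simpa [linIdeal] using h k
  | succ j ih =>
    choose u hu v huv using fun k => mem_linIdeal_succ (h k)
    choose y hy hyv using fun k => exists_topSymbol_eq (n := n) (K := K)
      (MvPolynomial.homogeneousComponent_isHomogeneous r (v k))
    have hy' : y ∈ freeFil n K m r := mem_freeFil.mpr hy
    refine mem_frameSum_succ.mpr ⟨x - frameOp A j • y, ih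
      (Submodule.sub_mem _ hx (frameOp_smul_mem_freeFil A j hy')) fun k => ?_, y, hy', by simp⟩
    have e : topSymbol n K (r + 1) (x k) =
        MvPolynomial.homogeneousComponent (r + 1) (topSymbol n K (r + 1) (x k)) :=
      (MvPolynomial.homogeneousComponent_eq_self
        (MvPolynomial.homogeneousComponent_isHomogeneous _ _)).symm
    rw [Pi.sub_apply, Pi.smul_apply, smul_eq_mul, map_sub, topSymbol_frameOp_mul A j (hy k),
      e, huv, map_add, homogeneousComponent_linForm_mul, hyv, add_sub_cancel_right]
    exact homogeneousComponent_mem_linIdeal (hu k) _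

theorem isSymbolRegular_freeFil {A : Matrix (Fin n) (Fin n) K} (hA : IsUnit A) (m : ℕ) :
    IsSymbolRegular (frameOp A) n fun r => (freeFil n K m r).toAddSubgroup := by
  intro r i hi x hx h
  refine mem_frameSum_of_topSymbol_mem hx fun k =>
    mem_linIdeal_of_linForm_mul_mem (i := ⟨i, hi⟩) hA ?_
  have := topSymbol_mem_of_mem_frameSum h k
  rwa [Pi.smul_apply, smul_eq_mul, topSymbol_frameOp_mul A i (mem_freeFil.mp hx k)] at this

end DiffOp

/-! ### Duality between jets and equations; contractions of jets. -/

section JetPairing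

variable {n m q : ℕ} {K : Type*} [Field K]

theorem jet_eq_sum (v : Jet K n m q) :
    v = ∑ k, ∑ μ, v k μ • (Pi.single k (Pi.single μ 1) : Jet K n m q) := by
  funext k μ
  simp only [Finset.sum_apply, Pi.smul_apply, smul_eq_mul]
  rw [Finset.sum_eq_single k, Finset.sum_eq_single μ]
  · simp
  · intro ν _ h; simp [h.symm]
  · simp
  · intro l _ h
    exact Finset.sum_eq_zero fun ν _ => by simp [Pi.single_eq_of_ne h.symm]
  · simp

theorem linearMap_jet_apply (f : Jet K n m q →ₗ[K] K) (v : Jet K n m q) :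
    f v = ∑ k, ∑ μ, f (Pi.single k (Pi.single μ 1)) * v k μ := by
  conv_lhs => rw [jet_eq_sum v]
  simp only [map_sum, map_smul, smul_eq_mul, mul_comm]

/-- A vector killed by all linear forms that vanish on `W` lies in `W`. -/
theorem mem_of_forall_pairing_eq_zero {W : Submodule K (Jet K n m q)} {v : Jet K n m q}
    (h : ∀ a : Jet K n m q, (∀ w ∈ W, ∑ k, ∑ μ, a k μ * w k μ = 0) →
      ∑ k, ∑ μ, a k μ * v k μ = 0) : v ∈ W := by
  by_contra hv
  obtain ⟨f, hf, hW⟩ := Submodule.exists_le_ker_of_notMem hv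
  refine hf ?_
  rw [linearMap_jet_apply]
  refine h _ fun w hw => ?_
  rw [← linearMap_jet_apply]
  exact hW hw

theorem mem_of_equations {R : Submodule K (Jet K n m q)} {v : Jet K n m q}
    (h : ∀ a ∈ equations R, ∑ k, ∑ μ, a k μ * v k μ = 0) : v ∈ R :=
  mem_of_forall_pairing_eq_zero h

variable (K n m q) in
/-- The pairing of linear forms with jets. -/
def jetPairing : Jet K n m q →ₗ[K] Module.Dual K (Jet K n m q) :=
  LinearMap.mk₂ K (fun a v => ∑ k, ∑ μ, a k μ * v k μ)
    (fun a b v => by simp [add_mul, Finset.sum_add_distrib])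
    (fun c a v => by simp [mul_assoc, Finset.mul_sum])
    (fun a v w => by simp [mul_add, Finset.sum_add_distrib])
    (fun c a v => by simp [mul_left_comm _ c, Finset.mul_sum])

theorem jetPairing_apply (a v : Jet K n m q) :
    jetPairing n m q K a v = ∑ k, ∑ μ, a k μ * v k μ := rfl

theorem jetPairing_bijective : Function.Bijective (jetPairing n m q K) := by
  have hi : Function.Injective (jetPairing n m q K) := by
    refine (injective_iff_map_eq_zero _).mpr fun a ha => ?_
    have : a ∈ (⊥ : Submodule K (Jet K n m q)) := by
      refine mem_of_forall_pairing_eq_zero fun b _ => ?_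
      have := LinearMap.congr_fun ha b
      rw [jetPairing_apply] at this
      simpa only [mul_comm, LinearMap.zero_apply] using this
    simpa using this
  exact ⟨hi, (LinearMap.injective_iff_surjective_of_finrank_eq_finrank
    Subspace.dual_finrank_eq.symm).mp hi⟩

theorem finrank_add_finrank_equations (R : Submodule K (Jet K n m q)) :
    Module.finrank K R + Module.finrank K (equations R) = Module.finrank K (Jet K n m q) := by
  have e : (equations R).map (jetPairing n m q K) = R.dualAnnihilator := by
    ext φ
    rw [Submodule.mem_dualAnnihilator]
    constructor
    · rintro ⟨a, ha, rfl⟩ v hv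
      exact ha v hv
    · intro h
      obtain ⟨a, rfl⟩ := jetPairing_bijective.2 φ
      exact ⟨a, h, rfl⟩
  rw [← Subspace.finrank_add_finrank_dualAnnihilator_eq R, ← e,
    (Submodule.equivMapOfInjective _ jetPairing_bijective.1 (equations R)).finrank_eq]

/-- The rows of `A`, extended by zero to all `j`. -/
def rowCoeff (A : Matrix (Fin n) (Fin n) K) (j : ℕ) (l : Fin n) : K :=
  if h : j < n then A ⟨j, h⟩ l else 0

/-- The contraction of jets with the `j`-th vector of a frame. -/
def contract (A : Matrix (Fin n) (Fin n) K) (j : ℕ) : Jet K n m (q + 1) →ₗ[K] Jet K n m q where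
  toFun u k ν := ∑ l, rowCoeff A j l * u k (ν.inc l)
  map_add' u v := by
    funext k ν
    simp [mul_add, Finset.sum_add_distrib]
  map_smul' c u := by
    funext k ν
    simp [mul_left_comm _ c, Finset.mul_sum]

theorem contract_apply (A : Matrix (Fin n) (Fin n) K) (j : ℕ) (u : Jet K n m (q + 1)) (k : Fin m)
    (ν : MIdx n q) : contract A j u k ν = ∑ l, rowCoeff A j l * u k (ν.inc l) := rfl

theorem mem_symbolClass {R : Submodule K (Jet K n m q)} {A : Matrix (Fin n) (Fin n) K} {i : ℕ}
    {v : Jet K n m q} : v ∈ symbolClass R A i ↔ v ∈ symbol R ∧ ∀ j < i, ∀ k, ∀ ν : Fin n → ℕ,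
      ∀ hν : mlen ν < q,
        ∑ l, rowCoeff A j l * v k ⟨ν + Pi.single l 1, (mlen_add_single ν l).trans_le hν⟩ = 0 := by
  refine and_congr_right fun _ => ⟨fun h j hj k ν hν => ?_, fun h j hj k ν hν => ?_⟩
  · by_cases hjn : j < n
    · simpa [rowCoeff, hjn] using h ⟨j, hjn⟩ hj k ν hν
    · simp [rowCoeff, hjn]
  · simpa [rowCoeff] using h j hj k ν hν

theorem symbolClass_zero (R : Submodule K (Jet K n m q)) (A : Matrix (Fin n) (Fin n) K) :
    symbolClass R A 0 = symbol R := by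
  ext v
  simp [mem_symbolClass]

theorem mem_symbolClass_iff_contract {R : Submodule K (Jet K n m (q + 1))}
    {A : Matrix (Fin n) (Fin n) K} {i : ℕ} {v : Jet K n m (q + 1)} :
    v ∈ symbolClass R A i ↔ v ∈ symbol R ∧ ∀ j < i, contract A j v = 0 := by
  rw [mem_symbolClass]
  refine and_congr_right fun _ => forall₂_congr fun j _ => ⟨fun h => ?_, fun h k ν hν => ?_⟩
  · funext k ν
    exact h k ν.1 (Nat.lt_succ_of_le ν.2)
  · exact congrFun (congrFun h k) ⟨ν, Nat.le_of_lt_succ hν⟩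

theorem symbolClass_succ (R : Submodule K (Jet K n m (q + 1))) (A : Matrix (Fin n) (Fin n) K)
    (i : ℕ) : symbolClass R A (i + 1) = symbolClass R A i ⊓ LinearMap.ker (contract A i) := by
  ext v
  simp only [Submodule.mem_inf, mem_symbolClass_iff_contract, LinearMap.mem_ker, and_assoc,
    Nat.lt_succ_iff_lt_or_eq]
  refine and_congr_right fun _ => ⟨fun h => ⟨fun j hj => h j (.inl hj), h i (.inr rfl)⟩, ?_⟩
  rintro ⟨h1, h2⟩ j (hj | rfl)
  · exact h1 j hj
  · exact h2

/-- Invertibility of `A` turns the vanishing of all contractions into that of all components `ν +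
1_l`. In positive order these are all the top components. -/
theorem symbolClass_last (R : Submodule K (Jet K n m (q + 1))) {A : Matrix (Fin n) (Fin n) K}
    (hA : IsUnit A) : symbolClass R A n = ⊥ := by
  refine (Submodule.eq_bot_iff _).mpr fun v hv => ?_
  obtain ⟨⟨_, hv0⟩, hv⟩ := mem_symbolClass_iff_contract.mp hv
  funext k μ
  rcases Nat.lt_or_ge (mlen μ.1) (q + 1) with h | h
  · exact hv0 k μ h
  obtain ⟨ν, i, hν, hμ⟩ := exists_eq_add_single (le_antisymm μ.2 h)
  have h1 : A.mulVec (fun l => v k (MIdx.inc ⟨ν, hν.le⟩ l)) = A.mulVec 0 := by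
    funext j
    rw [Matrix.mulVec_zero]
    simpa [rowCoeff, contract_apply, Matrix.mulVec, dotProduct] using
      congrFun (congrFun (hv j j.2) k) ⟨ν, hν.le⟩
  have h2 := congrFun (Matrix.mulVec_injective_of_isUnit hA h1) i
  rw [show μ = MIdx.inc ⟨ν, hν.le⟩ i from Subtype.ext hμ]
  exact h2

/-- Rank-nullity for the contraction, whose kernel on one class is the next class. Summed over `i`
it telescopes. -/
theorem finrank_symbolClass_eq_add (R : Submodule K (Jet K n m (q + 1)))
    (A : Matrix (Fin n) (Fin n) K) (i : ℕ) :
    Module.finrank K (symbolClass R A i) =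
      Module.finrank K ((symbolClass R A i).map (contract A i)) +
        Module.finrank K (symbolClass R A (i + 1)) := by
  have h := LinearMap.finrank_range_add_finrank_ker
    ((contract A i).domRestrict (symbolClass R A i))
  rw [← h, LinearMap.range_domRestrict, symbolClass_succ, LinearMap.ker_domRestrict,
    ← Submodule.finrank_map_subtype_eq, Submodule.map_comap_subtype]

end JetPairing

/-! ### Involutivity as surjectivity of contractions. -/

section Prolongation

variable {n m q : ℕ} {K : Type*} [Field K] [PartialDifferentialField n K]

/-- On a jet without lower-order part the terms `∂_i a` drop out of the prolonged equations, so
every index shift of it solves the original ones. Contractions commute, so the class conditions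
survive. -/
theorem contract_mem {R : Submodule K (Jet K n m q)} {A : Matrix (Fin n) (Fin n) K} {i : ℕ}
    {u : Jet K n m (q + 1)} (hu : u ∈ symbolClass (prolong R) A i) (j : ℕ) :
    contract A j u ∈ symbolClass R A i := by
  obtain ⟨⟨huR, hu0⟩, hui⟩ := mem_symbolClass.mp hu
  have hup (k : Fin m) (μ : MIdx n q) : u k μ.up = 0 := hu0 k _ (Nat.lt_succ_of_le μ.2)
  refine mem_symbolClass.mpr ⟨⟨mem_of_equations fun a ha => ?_, fun k μ hμ => ?_⟩,
    fun j' hj' k ν hν => ?_⟩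
  · simp only [contract_apply, Finset.mul_sum]
    have h (l : Fin n) : ∑ k, ∑ μ, a k μ * u k (μ.inc l) = 0 := by
      simpa [hup] using (huR a ha).2 l
    calc _ = ∑ k, ∑ l, ∑ μ, rowCoeff A j l * (a k μ * u k (μ.inc l)) :=
          Finset.sum_congr rfl fun k _ => by
            rw [Finset.sum_comm]
            exact Finset.sum_congr rfl fun _ _ => Finset.sum_congr rfl fun _ _ =>
              mul_left_comm _ _ _
      _ = ∑ l, rowCoeff A j l * ∑ k, ∑ μ, a k μ * u k (μ.inc l) := by
          rw [Finset.sum_comm]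
          simp only [Finset.mul_sum]
      _ = 0 := by simp [h]
  · rw [contract_apply]
    refine Finset.sum_eq_zero fun l _ => ?_
    rw [hu0 k _ (by change mlen (μ.1 + _) < _; rw [mlen_add_single]; omega), mul_zero]
  · simp only [contract_apply, Finset.mul_sum]
    rw [Finset.sum_comm]
    refine Finset.sum_eq_zero fun l _ => ?_
    have := hui j' hj' k (ν + Pi.single l 1) (by rw [mlen_add_single]; omega)
    rw [← mul_zero (rowCoeff A j l), ← this, Finset.mul_sum]
    refine Finset.sum_congr rfl fun l' _ => ?_
    rw [mul_left_comm]
    congr 3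
    exact Subtype.ext (add_right_comm ν (Pi.single l' 1) (Pi.single l 1))

/-- For an involutive system the contractions with the vectors of a quasi-regular frame are
surjective. -/
theorem map_contract_eq {R : Submodule K (Jet K n m q)} {A : Matrix (Fin n) (Fin n) K}
    (hA : IsUnit A) (h : Module.finrank K (symbol (prolong R)) =
      ∑ i ∈ Finset.range n, Module.finrank K (symbolClass R A i)) {i : ℕ} (hi : i < n) :
    (symbolClass (prolong R) A i).map (contract A i) = symbolClass R A i := by
  have hle (i : ℕ) : (symbolClass (prolong R) A i).map (contract A i) ≤ symbolClass R A i := by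
    rintro _ ⟨u, hu, rfl⟩
    exact contract_mem hu i
  have hsum (N : ℕ) : Module.finrank K (symbol (prolong R)) =
      ∑ i ∈ Finset.range N, Module.finrank K ((symbolClass (prolong R) A i).map (contract A i)) +
        Module.finrank K (symbolClass (prolong R) A N) := by
    induction N with
    | zero => rw [symbolClass_zero, Finset.sum_range_zero, zero_add]
    | succ N ih =>
      rw [ih, Finset.sum_range_succ, finrank_symbolClass_eq_add, add_assoc]
  -- `dim g_{q+1}` is the sum of the dimensions of the images. Each is bounded by the corresponding
  -- `dim g_q^{(i)}`, so equality of the sums forces equality term by term.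
  have h1 := hsum n
  rw [symbolClass_last _ hA, finrank_bot, add_zero, h] at h1
  exact Submodule.eq_of_le_of_finrank_eq (hle i) (((Finset.sum_eq_sum_iff_of_le
    fun i _ => Submodule.finrank_mono (hle i)).mp h1.symm) i (Finset.mem_range.mpr hi))

end Prolongation

/-! ### Involutivity in terms of equations in `Dᵐ`. -/

section JetEval

open DiffOp

variable {n m q : ℕ} {K : Type*} [Field K] [PartialDifferentialField n K]

theorem frameOp_smul_eq_sum {F : Type*} [AddCommGroup F] [Module K F] [Module (DiffOp n K) F]
    [IsScalarTower K (DiffOp n K) F] (A : Matrix (Fin n) (Fin n) K) (j : ℕ) (x : F) :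
    frameOp A j • x = ∑ l, rowCoeff A j l • d K l • x := by
  rw [frameOp_smul]
  split_ifs with h <;> simp [rowCoeff, h]

variable (n m q K) in
/-- The linear map that sends the coefficients of an equation to the equation. -/
def rowMap : Jet K n m q →ₗ[K] (Fin m → DiffOp n K) where
  toFun := equationRow
  map_add' a b := by
    funext k
    simp [equationRow, add_mul, Finset.sum_add_distrib]
  map_smul' c a := by
    funext k
    simp [equationRow, smul_def, Finset.mul_sum, mul_assoc]

theorem rowMap_apply (a : Jet K n m q) : rowMap n m q K a = equationRow a := rfl

theorem rowMap_eq_sum (a : Jet K n m q) :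
    rowMap n m q K a = ∑ k, ∑ μ, a k μ • Pi.single k (monomial μ.1) := by
  funext k
  simp only [Finset.sum_apply, Pi.smul_apply]
  rw [Finset.sum_eq_single k]
  · simp [rowMap_apply, equationRow, smul_def]
  · intro l _ h
    exact Finset.sum_eq_zero fun μ _ => by rw [Pi.single_eq_of_ne h.symm, smul_zero]
  · simp

theorem single_monomial_mem_freeFil (k : Fin m) {μ : Fin n → ℕ} {r : ℕ} (h : mlen μ ≤ r) :
    Pi.single k (monomial μ) ∈ freeFil n K m r := by
  refine mem_freeFil.mpr fun l => ?_
  by_cases hl : l = k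
  · subst hl
    rw [Pi.single_eq_same]
    exact monomial_mem_orderLE h
  · rw [Pi.single_eq_of_ne hl]
    exact Submodule.zero_mem _

theorem range_rowMap : LinearMap.range (rowMap n m q K) = freeFil n K m q := by
  apply le_antisymm
  · rintro _ ⟨a, rfl⟩
    rw [rowMap_eq_sum]
    exact Submodule.sum_mem _ fun k _ => Submodule.sum_mem _ fun μ _ =>
      Submodule.smul_mem _ _ (single_monomial_mem_freeFil k μ.2)
  · intro x hx
    have h (k : Fin m) : ∃ c : MIdx n q → K, ∑ μ, c μ • monomial μ.1 = x k := by
      refine (Submodule.mem_span_range_iff_exists_fun K).mp ?_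
      have e : Set.range (fun μ : MIdx n q => monomial (K := K) μ.1) =
          {P | ∃ μ : Fin n → ℕ, mlen μ ≤ q ∧ P = monomial μ} := by
        ext P
        exact ⟨fun ⟨μ, h⟩ => ⟨μ.1, μ.2, h.symm⟩, fun ⟨μ, h, e⟩ => ⟨⟨μ, h⟩, e.symm⟩⟩
      rw [e]
      exact mem_freeFil.mp hx k
    choose c hc using h
    refine ⟨c, funext fun k => ?_⟩
    rw [← hc k]
    rfl

theorem exists_rowMap_eq {x : Fin m → DiffOp n K} (hx : x ∈ freeFil n K m q) :
    ∃ a, rowMap n m q K a = x := by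
  rwa [← range_rowMap] at hx

theorem rowMap_mem_freeFil (a : Jet K n m q) : rowMap n m q K a ∈ freeFil n K m q :=
  range_rowMap.le ⟨a, rfl⟩

/-- A jet of order `q`, extended by zero to a linear form on `Dᵐ`. -/
def jetEval (v : Jet K n m q) : (Fin m → DiffOp n K) →ₗ[K] K :=
  ∑ k, (monomialBasis n K).constr K (fun μ => if h : mlen μ ≤ q then v k ⟨μ, h⟩ else 0) ∘ₗ
    LinearMap.proj k

theorem jetEval_single_monomial (v : Jet K n m q) (k : Fin m) (μ : Fin n → ℕ) :
    jetEval v (Pi.single k (monomial μ)) = if h : mlen μ ≤ q then v k ⟨μ, h⟩ else 0 := by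
  rw [jetEval, LinearMap.sum_apply, Finset.sum_eq_single k]
  · rw [LinearMap.comp_apply, LinearMap.proj_apply, Pi.single_eq_same, ← monomialBasis_apply,
      Module.Basis.constr_basis]
  · intro l _ h
    rw [LinearMap.comp_apply, LinearMap.proj_apply, Pi.single_eq_of_ne h, map_zero]
  · simp

theorem jetEval_rowMap (a v : Jet K n m q) :
    jetEval v (rowMap n m q K a) = ∑ k, ∑ μ, a k μ * v k μ := by
  rw [rowMap_eq_sum]
  simp only [map_sum, map_smul, smul_eq_mul]
  refine Finset.sum_congr rfl fun k _ => Finset.sum_congr rfl fun μ _ => ?_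
  rw [jetEval_single_monomial, dif_pos μ.2]

theorem jetEval_rowMap_up (a : Jet K n m q) (u : Jet K n m (q + 1)) :
    jetEval u (rowMap n m q K a) = ∑ k, ∑ μ, a k μ * u k μ.up := by
  rw [rowMap_eq_sum]
  simp only [map_sum, map_smul, smul_eq_mul]
  refine Finset.sum_congr rfl fun k _ => Finset.sum_congr rfl fun μ _ => ?_
  rw [jetEval_single_monomial, dif_pos (μ.2.trans (Nat.le_succ q))]
  rfl

theorem d_smul_single_monomial (i : Fin n) (k : Fin m) (μ : Fin n → ℕ) :
    d K i • (Pi.single k (monomial μ) : Fin m → DiffOp n K) =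
      Pi.single k (monomial (μ + Pi.single i 1)) := by
  rw [← Pi.single_smul, smul_eq_mul, d_mul_monomial]

/-- Left multiplication by `d_i` yields exactly the differentiated equation in `prolong`. -/
theorem jetEval_d_smul_rowMap (i : Fin n) (a : Jet K n m q) (u : Jet K n m (q + 1)) :
    jetEval u (d K i • rowMap n m q K a) =
      ∑ k, ∑ μ, (a k μ * u k (μ.inc i) + pd i (a k μ) * u k μ.up) := by
  rw [rowMap_eq_sum]
  simp only [Finset.smul_sum, d_smul_smul, map_sum, map_add, map_smul, smul_eq_mul]
  refine Finset.sum_congr rfl fun k _ => Finset.sum_congr rfl fun μ _ => ?_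
  rw [d_smul_single_monomial, jetEval_single_monomial, jetEval_single_monomial,
    dif_pos (μ.2.trans (Nat.le_succ q)), dif_pos (mlen_add_single μ.1 i ▸ Nat.succ_le_succ μ.2)]
  rfl

theorem jetEval_frameOp_smul_rowMap (A : Matrix (Fin n) (Fin n) K) (j : ℕ) (a : Jet K n m q)
    {u : Jet K n m (q + 1)} (hu : ∀ k μ, mlen μ.1 < q + 1 → u k μ = 0) :
    jetEval u (frameOp A j • rowMap n m q K a) = ∑ k, ∑ μ, a k μ * contract A j u k μ := by
  have hup (k : Fin m) (μ : MIdx n q) : u k μ.up = 0 := hu k _ (Nat.lt_succ_of_le μ.2)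
  rw [frameOp_smul_eq_sum]
  simp only [map_sum, map_smul, jetEval_d_smul_rowMap, hup, mul_zero, add_zero, contract_apply,
    smul_eq_mul]
  simp only [Finset.mul_sum]
  rw [Finset.sum_comm]
  refine Finset.sum_congr rfl fun k _ => ?_
  rw [Finset.sum_comm]
  exact Finset.sum_congr rfl fun _ _ => Finset.sum_congr rfl fun _ _ => mul_left_comm _ _ _

/-- The equations of the system as a subgroup of `Dᵐ`. -/
def rows (R : Submodule K (Jet K n m q)) : Submodule K (Fin m → DiffOp n K) :=
  (equations R).map (rowMap n m q K)

theorem rows_le_freeFil (R : Submodule K (Jet K n m q)) : rows R ≤ freeFil n K m q := by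
  rintro _ ⟨a, _, rfl⟩
  exact rowMap_mem_freeFil a

theorem jetEval_eq_zero_of_mem_prolong {R : Submodule K (Jet K n m q)}
    {A : Matrix (Fin n) (Fin n) K} {j : ℕ} {u : Jet K n m (q + 1)} (hu : u ∈ prolong R)
    {x : Fin m → DiffOp n K} (hx : x ∈ frameSum (frameOp A) (rows R).toAddSubgroup j) :
    jetEval u x = 0 := by
  refine frameSum_induction (p := fun x : Fin m → DiffOp n K => jetEval u x = 0) ?_ ?_
    (fun x y hx hy => by rw [map_add, hx, hy, add_zero]) hx
  · rintro _ ⟨a, ha, rfl⟩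
    rw [jetEval_rowMap_up]
    exact (hu a ha).1
  · rintro k - _ ⟨a, ha, rfl⟩
    rw [frameOp_smul_eq_sum, map_sum]
    refine Finset.sum_eq_zero fun l _ => ?_
    rw [map_smul, jetEval_d_smul_rowMap, (hu a ha).2 l, smul_zero]

theorem jetEval_eq_zero_of_contract {A : Matrix (Fin n) (Fin n) K} {j : ℕ}
    {u : Jet K n m (q + 1)} (hu : ∀ k μ, mlen μ.1 < q + 1 → u k μ = 0)
    (huj : ∀ i < j, contract A i u = 0) {x : Fin m → DiffOp n K}
    (hx : x ∈ frameSum (frameOp A) (freeFil n K m q).toAddSubgroup j) :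
    jetEval u x = 0 := by
  refine frameSum_induction (p := fun x : Fin m → DiffOp n K => jetEval u x = 0)
    (fun x hx => ?_) (fun k hk x hx => ?_)
    (fun x y hx hy => by rw [map_add, hx, hy, add_zero]) hx
  · obtain ⟨a, rfl⟩ := exists_rowMap_eq hx
    rw [jetEval_rowMap_up]
    exact Finset.sum_eq_zero fun k _ => Finset.sum_eq_zero fun μ _ => by
      rw [hu k _ (Nat.lt_succ_of_le μ.2), mul_zero]
  · obtain ⟨a, rfl⟩ := exists_rowMap_eq hx
    rw [jetEval_frameOp_smul_rowMap A k a hu, huj k hk]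
    simp

/-- `frameSum` preserves `K`-stable subgroups. -/
theorem smul_mem_frameSum_frameOp (A : Matrix (Fin n) (Fin n) K)
    {G : Submodule K (Fin m → DiffOp n K)} {j : ℕ} (a : K) {x : Fin m → DiffOp n K}
    (hx : x ∈ frameSum (frameOp A) G.toAddSubgroup j) :
    a • x ∈ frameSum (frameOp A) G.toAddSubgroup j := by
  refine frameSum_induction
    (p := fun x : Fin m → DiffOp n K => a • x ∈ frameSum (frameOp A) G.toAddSubgroup j)
    (fun x hx => le_frameSum j (G.smul_mem a hx)) (fun k hk x hx => ?_)
    (fun x y hx hy => by rw [smul_add]; exact add_mem hx hy) hx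
  -- `ξ_k` is not `K`-linear, but the Leibniz correction stays in `G`, which lies in every
  -- `frameSum`.
  rw [← sub_eq_of_eq_add (frameOp_smul_smul A k a x)]
  exact sub_mem (smul_mem_frameSum hk (G.smul_mem a hx)) (le_frameSum j (G.smul_mem _ hx))

/-- The elements of order at most `q` that `ξ_j` maps into `F_q + ∑_{k<j} ξ_k F_q`. -/
def colonFil (A : Matrix (Fin n) (Fin n) K) (m q j : ℕ) :
    Submodule K (Fin m → DiffOp n K) where
  carrier := {x | x ∈ freeFil n K m q ∧
    frameOp A j • x ∈ frameSum (frameOp A) (freeFil n K m q).toAddSubgroup j}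
  zero_mem' := ⟨zero_mem _, by rw [smul_zero]; exact zero_mem _⟩
  add_mem' := fun hx hy => ⟨add_mem hx.1 hy.1, by rw [smul_add]; exact add_mem hx.2 hy.2⟩
  smul_mem' := fun a x hx => ⟨Submodule.smul_mem _ a hx.1, by
    rw [frameOp_smul_smul]
    exact add_mem (smul_mem_frameSum_frameOp A a hx.2)
      (le_frameSum j (Submodule.smul_mem _ _ hx.1))⟩

theorem freeFil_le_colonFil {A : Matrix (Fin n) (Fin n) K} {j r : ℕ} {x : Fin m → DiffOp n K}
    (hx : x ∈ freeFil n K m r) (hr : r < q) : x ∈ colonFil A m q j :=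
  ⟨freeFil_mono m hr.le hx, le_frameSum j (freeFil_mono m hr (frameOp_smul_mem_freeFil A j hx))⟩

theorem frameOp_smul_mem_colonFil {A : Matrix (Fin n) (Fin n) K}
    (hA : ∀ i j l, pd (n := n) l (A i j) = 0) {j k r : ℕ} (hk : k < j) {x : Fin m → DiffOp n K}
    (hx : x ∈ freeFil n K m r) (hr : r < q) : frameOp A k • x ∈ colonFil A m q j := by
  refine ⟨freeFil_mono m hr (frameOp_smul_mem_freeFil A k hx), ?_⟩
  rw [← mul_smul, frameOp_comm hA, mul_smul]
  exact smul_mem_frameSum hk (freeFil_mono m hr (frameOp_smul_mem_freeFil A j hx))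

/-- An equation that vanishes on `symbolClass R A j` is the sum of an equation of `R` and of an
equation whose symbol lies in the ideal of the first `j` vectors of the frame. -/
theorem rowMap_mem_rows_sup_colonFil {R : Submodule K (Jet K n m q)}
    {A : Matrix (Fin n) (Fin n) K} (hA : ∀ i j l, pd (n := n) l (A i j) = 0) {j : ℕ}
    {a : Jet K n m q} (ha : ∀ v ∈ symbolClass R A j, ∑ k, ∑ μ, a k μ * v k μ = 0) :
    rowMap n m q K a ∈ rows R ⊔ colonFil A m q j := by
  suffices h : a ∈ (rows R ⊔ colonFil A m q j).comap (rowMap n m q K) from h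
  -- By biduality, test a jet `v` that annihilates both summands. Annihilating the equations puts it
  -- in `R`. When `q > 0`, `colonFil` contains the elements of order `q - 1` and their multiples by
  -- `ξ_i`, `i < j`, so the lower components and the contractions of `v` vanish too.
  refine mem_of_forall_pairing_eq_zero fun v hv => ?_
  have hv' {b : Jet K n m q} (hb : rowMap n m q K b ∈ rows R ⊔ colonFil A m q j) :
      jetEval v (rowMap n m q K b) = 0 := by
    rw [jetEval_rowMap, ← hv b hb]
    simp only [mul_comm]
  have hv'' {x : Fin m → DiffOp n K} (hx : x ∈ colonFil A m q j) : jetEval v x = 0 := by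
    obtain ⟨b, rfl⟩ := exists_rowMap_eq hx.1
    exact hv' (Submodule.mem_sup_right hx)
  have key : v ∈ symbolClass R A j := by
    refine mem_symbolClass.mpr ⟨⟨mem_of_equations fun b hb => ?_, fun k μ hμ => ?_⟩,
      fun i hi k ν hν => ?_⟩
    · rw [← jetEval_rowMap]
      exact hv' (Submodule.mem_sup_left ⟨b, hb, rfl⟩)
    · have := hv'' (freeFil_le_colonFil (A := A) (j := j)
        (single_monomial_mem_freeFil (K := K) k le_rfl) hμ)
      rwa [jetEval_single_monomial, dif_pos μ.2] at this
    · have := hv'' (frameOp_smul_mem_colonFil hA hi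
        (single_monomial_mem_freeFil (K := K) k (le_refl (mlen ν))) hν)
      rw [frameOp_smul_eq_sum, map_sum] at this
      rw [← this]
      refine Finset.sum_congr rfl fun l _ => ?_
      rw [map_smul, d_smul_single_monomial, jetEval_single_monomial,
        dif_pos ((mlen_add_single ν l).trans_le hν), smul_eq_mul]
  rw [← ha v key]
  simp only [mul_comm]

/-- An involutive system of order `q` in terms of its equations. -/
theorem isQuasiRegular_rows {R : Submodule K (Jet K n m q)} {A : Matrix (Fin n) (Fin n) K}
    (hproj : (prolong R).map jetProj = R) (hA : IsUnit A)
    (hAc : ∀ i j l, pd (n := n) l (A i j) = 0)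
    (hdim : Module.finrank K (symbol (prolong R)) =
      ∑ i ∈ Finset.range n, Module.finrank K (symbolClass R A i)) :
    IsQuasiRegular (frameOp A) n (freeFil n K m q).toAddSubgroup (rows R).toAddSubgroup := by
  intro j
  induction j with
  | zero =>
    rintro - x hx hxF
    obtain ⟨a, rfl⟩ := exists_rowMap_eq hxF
    -- Every jet of `R` lifts to the prolongation, and the lift annihilates `x`.
    refine ⟨a, fun v hv => ?_, rfl⟩
    rw [← hproj] at hv
    obtain ⟨u, hu, rfl⟩ := hv
    rw [← jetEval_eq_zero_of_mem_prolong hu hx, jetEval_rowMap_up]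
    rfl
  | succ j ih =>
    intro hj x hx hxF
    obtain ⟨t, ht, p, hp, rfl⟩ := mem_frameSum_succ.mp hxF
    obtain ⟨a, rfl⟩ := exists_rowMap_eq hp
    -- Such a `v` is the `j`-th contraction of some `u` in the same class of the prolonged symbol.
    -- This `u` annihilates both `x` and `t`, hence `ξ_j p`, so the equation `p` vanishes on `v`.
    have ha : ∀ v ∈ symbolClass R A j, ∑ k, ∑ μ, a k μ * v k μ = 0 := by
      intro v hv
      rw [← map_contract_eq hA hdim hj] at hv
      obtain ⟨u, hu, rfl⟩ := hv
      obtain ⟨⟨huR, hu0⟩, huj⟩ := mem_symbolClass_iff_contract.mp hu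
      have h1 := jetEval_eq_zero_of_mem_prolong huR hx
      rwa [map_add, jetEval_eq_zero_of_contract hu0 huj ht, zero_add,
        jetEval_frameOp_smul_rowMap A j a hu0] at h1
    -- Split `p` as `b + c`: `b` is an equation of the system, and `ξ_j c` can be merged into `t`,
    -- which leaves one frame vector fewer.
    obtain ⟨b, hb, c, hc, hbc⟩ := Submodule.mem_sup.mp (rowMap_mem_rows_sup_colonFil hAc ha)
    rw [← hbc] at hx ⊢
    refine mem_frameSum_succ.mpr ⟨t + frameOp A j • c, ih (Nat.le_of_succ_le hj) _ ?_
      (add_mem ht hc.2), b, hb, by rw [smul_add]; abel⟩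
    have e : t + frameOp A j • c = t + frameOp A j • (b + c) - frameOp A j • b := by
      rw [smul_add]; abel
    rw [e]
    exact sub_mem hx (smul_mem_frameSum hj hb)

end JetEval

/-! ### Linear forms that detect every vector of high order. -/

section DetectingFunctional

variable {K M : Type*} [Field K] [AddCommGroup M] [Module K M]

/-- `ξ^[i] (a • x)` is a `K`-combination of the iterates of `x` up to the `i`-th. Hence the
simultaneous vanishing on an initial segment of iterates is a linear condition, although `ξ` is not
linear. -/
theorem apply_iterate_smul_eq_zero {ξ : M →+ M} {δ : K → K}
    (hξ : ∀ (a : K) x, ξ (a • x) = a • ξ x + δ a • x) (f : M →ₗ[K] K) (j : ℕ) (a : K) (x : M)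
    (h : ∀ i < j, f (ξ^[i] x) = 0) : ∀ i < j, f (ξ^[i] (a • x)) = 0 := by
  intro i hi
  induction i generalizing x j a with
  | zero =>
    have := h 0 hi
    rw [Function.iterate_zero_apply] at this ⊢
    rw [map_smul, this, smul_zero]
  | succ i ih =>
    rw [Function.iterate_succ_apply, hξ, iterate_map_add, map_add,
      ih (i + 1) a (ξ x) (fun i' hi' => by
        rw [← Function.iterate_succ_apply]; exact h _ (by omega)) (Nat.lt_succ_self i),
      ih (i + 1) (δ a) x (fun i' hi' => h _ (by omega)) (Nat.lt_succ_self i), add_zero]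

/-- The vectors of `V` whose first `j` iterates under `ξ` are killed by `f`. -/
def iterateKer {ξ : M →+ M} {δ : K → K} (hξ : ∀ (a : K) x, ξ (a • x) = a • ξ x + δ a • x)
    (V : Submodule K M) (f : M →ₗ[K] K) (j : ℕ) : Submodule K M where
  carrier := {x | x ∈ V ∧ ∀ i < j, f (ξ^[i] x) = 0}
  zero_mem' := ⟨zero_mem _, fun i _ => by rw [iterate_map_zero, map_zero]⟩
  add_mem' hx hy := ⟨add_mem hx.1 hy.1, fun i hi => by
    rw [iterate_map_add, map_add, hx.2 i hi, hy.2 i hi, add_zero]⟩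
  smul_mem' a x hx := ⟨V.smul_mem a hx.1, apply_iterate_smul_eq_zero hξ f j a x hx.2⟩

/-- A compatible sequence of linear forms on an exhaustive filtration has a limit. -/
theorem exists_linearMap_of_compatible {V : ℕ → Submodule K M} (hV : Monotone V)
    (hex : ∀ x, ∃ r, x ∈ V r) (F : ℕ → M →ₗ[K] K)
    (hF : ∀ u, ∀ x ∈ V u, F (u + 1) x = F u x) :
    ∃ f : M →ₗ[K] K, ∀ u, ∀ x ∈ V u, f x = F u x := by
  have hF' {u v : ℕ} (h : u ≤ v) {x : M} (hx : x ∈ V u) : F v x = F u x := by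
    induction v, h using Nat.le_induction with
    | base => rfl
    | succ v huv ih => rw [hF v x (hV huv hx), ih]
  choose r hr using hex
  have key (u : ℕ) (x : M) (hx : x ∈ V u) : F (r x) x = F u x := by
    rcases le_total u (r x) with h | h
    · exact hF' h hx
    · exact (hF' h (hr x)).symm
  refine ⟨{ toFun := fun x => F (r x) x, map_add' := fun x y => ?_, map_smul' := fun a x => ?_ },
    key⟩
  · have hx := hV (le_max_left (r x) (r y)) (hr x)
    have hy := hV (le_max_right (r x) (r y)) (hr y)
    rw [key _ _ (add_mem hx hy), map_add, key _ _ hx, key _ _ hy]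
  · rw [key _ _ ((V (r x)).smul_mem a (hr x)), map_smul]
    rfl

variable {V : ℕ → Submodule K M} {ξ : M →+ M} {q : ℕ}

theorem iterate_mem_filtration (hstep : ∀ r, ∀ x ∈ V r, ξ x ∈ V (r + 1)) {r : ℕ} {x : M}
    (hx : x ∈ V r) (j : ℕ) : ξ^[j] x ∈ V (r + j) := by
  induction j with
  | zero => exact hx
  | succ j ih => rw [Function.iterate_succ_apply']; exact hstep _ _ ih

theorem iterate_notMem_filtration (hstep : ∀ r, ∀ x ∈ V r, ξ x ∈ V (r + 1))
    (hinj : ∀ s ≥ q, ∀ x ∈ V (s + 1), ξ x ∈ V (s + 1) → x ∈ V s) {s : ℕ} (hs : q ≤ s) {x : M}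
    (hx : x ∈ V (s + 1)) (hxs : x ∉ V s) (j : ℕ) : ξ^[j] x ∉ V (s + j) := by
  induction j with
  | zero => exact hxs
  | succ j ih =>
    rw [Function.iterate_succ_apply']
    have := iterate_mem_filtration hstep hx j
    rw [add_right_comm] at this
    exact fun h => ih (hinj _ (by omega) _ this h)

/-- If `ξ` raises the order of every vector of order greater than `q`, then every linear form can
be changed outside `V q` so that no such vector has all its iterates in the kernel. -/
theorem exists_detecting_functional {δ : K → K} (hV : Monotone V) (hex : ∀ x, ∃ r, x ∈ V r)
    (hfin : ∀ r, Module.Finite K (V r))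
    (hξ : ∀ (a : K) x, ξ (a • x) = a • ξ x + δ a • x)
    (hstep : ∀ r, ∀ x ∈ V r, ξ x ∈ V (r + 1))
    (hinj : ∀ s ≥ q, ∀ x ∈ V (s + 1), ξ x ∈ V (s + 1) → x ∈ V s) (f₀ : M →ₗ[K] K) :
    ∃ f : M →ₗ[K] K, (∀ x ∈ V q, f x = f₀ x) ∧
      ∀ s ≥ q, ∀ x ∈ V (s + 1), x ∉ V s → ∃ j, f (ξ^[j] x) ≠ 0 := by
  -- Step `u` serves the order `s = u.unpair.1`, and `u - s` is the exponent for which `ξ` takes `V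
  -- (s + 1)` into `V (u + 1)`. If some `x` outside `V s` has all earlier iterates killed, its next
  -- iterate lies outside `V u` and can be given a nonzero value without touching `V u`. The maximum
  -- with `q` protects the prescribed values on `V q`.
  have hnext (u : ℕ) (g : M →ₗ[K] K) : ∃ g' : M →ₗ[K] K, (∀ x ∈ V (max u q), g' x = g x) ∧
      (q ≤ u.unpair.1 → (∃ x ∈ iterateKer hξ (V (u.unpair.1 + 1)) g (u - u.unpair.1),
          x ∉ V u.unpair.1) →
        ∃ x ∈ iterateKer hξ (V (u.unpair.1 + 1)) g (u - u.unpair.1),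
          g' (ξ^[u - u.unpair.1] x) ≠ 0) := by
    by_cases h : q ≤ u.unpair.1 ∧ ∃ x ∈ iterateKer hξ (V (u.unpair.1 + 1)) g (u - u.unpair.1),
      x ∉ V u.unpair.1
    swap
    · exact ⟨g, fun _ _ => rfl, fun h1 h2 => absurd ⟨h1, h2⟩ h⟩
    obtain ⟨hq, x, hx, hxs⟩ := h
    by_cases hgx : g (ξ^[u - u.unpair.1] x) = 0
    swap
    · exact ⟨g, fun _ _ => rfl, fun _ _ => ⟨x, hx, hgx⟩⟩
    have hu : u.unpair.1 ≤ u := Nat.unpair_left_le u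
    have h1 := iterate_notMem_filtration hstep hinj hq hx.1 hxs (u - u.unpair.1)
    rw [Nat.add_sub_cancel' hu] at h1
    obtain ⟨φ, hφ, hφV⟩ := Submodule.exists_le_ker_of_notMem h1
    refine ⟨g + φ, fun y hy => ?_, fun _ _ => ⟨x, hx, ?_⟩⟩
    · rw [max_eq_left (hq.trans hu)] at hy
      rw [LinearMap.add_apply, show φ y = 0 from hφV hy, add_zero]
    · rwa [LinearMap.add_apply, hgx, zero_add]
  choose N hN hN' using hnext
  let F : ℕ → M →ₗ[K] K := fun u => Nat.rec f₀ N u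
  have hFmax (u : ℕ) : ∀ x ∈ V (max u q), F (u + 1) x = F u x := hN u (F u)
  obtain ⟨f, hf⟩ := exists_linearMap_of_compatible hV hex F fun u x hx =>
    hFmax u x (hV (le_max_left u q) hx)
  have hF0 (u : ℕ) : ∀ x ∈ V q, F u x = f₀ x := by
    induction u with
    | zero => exact fun _ _ => rfl
    | succ u ih => exact fun x hx => by rw [hFmax u x (hV (le_max_right u q) hx), ih x hx]
  refine ⟨f, fun x hx => by rw [hf q x hx, hF0 q x hx], fun s hs x hx hxs => ?_⟩
  by_contra! hzero
  -- The iterates tested before step `u` lie in `V u`, where `f` and `F u` agree.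
  have hW (u : ℕ) (hu : s ≤ u) :
      iterateKer hξ (V (s + 1)) f (u - s) = iterateKer hξ (V (s + 1)) (F u) (u - s) := by
    ext y
    refine and_congr_right fun hy => forall₂_congr fun i hi => ?_
    rw [hf u _ (hV (by omega) (iterate_mem_filtration hstep hy i))]
  -- `J k` is the exponent used at the `k`-th of the infinitely many visits to `s`. As long as an
  -- undetected `x` survives, each visit cuts the space of undetected vectors down strictly.
  let J : ℕ → ℕ := fun k => Nat.pair s k - s
  have hpair (k : ℕ) : s ≤ Nat.pair s k := Nat.left_le_pair s k
  have hJ (k : ℕ) : J k + 1 ≤ J (k + 1) := by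
    have : Nat.pair s k < Nat.pair s (k + 1) := Nat.pair_lt_pair_right s (Nat.lt_succ_self k)
    have := hpair k
    simp only [J]
    omega
  have hdrop (k : ℕ) : iterateKer hξ (V (s + 1)) f (J (k + 1)) <
      iterateKer hξ (V (s + 1)) f (J k) := by
    refine lt_of_le_of_ne (fun y hy => ⟨hy.1, fun i hi => hy.2 i (by have := hJ k; omega)⟩)
      fun heq => ?_
    have h := hN' (Nat.pair s k) (F (Nat.pair s k))
    simp only [Nat.unpair_pair] at h
    rw [← hW _ (hpair k)] at h
    obtain ⟨y, hy, hy'⟩ := h hs ⟨x, ⟨hx, fun i _ => hzero i⟩, hxs⟩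
    refine hy' ?_
    change F (Nat.pair s k + 1) _ = 0
    have hmem := iterate_mem_filtration hstep hy.1 (Nat.pair s k - s)
    rw [← hf (Nat.pair s k + 1) _ (hV (by have := hpair k; omega) hmem)]
    have hyJ : y ∈ iterateKer hξ (V (s + 1)) f (J (k + 1)) := heq ▸ hy
    exact hyJ.2 (J k) (hJ k)
  have hle (k : ℕ) : iterateKer hξ (V (s + 1)) f (J k) ≤ V (s + 1) := fun y hy => hy.1
  have hfd (k : ℕ) : Module.Finite K (iterateKer hξ (V (s + 1)) f (J k)) :=
    Submodule.finiteDimensional_of_le (hle k)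
  have hrank (k : ℕ) : Module.finrank K (iterateKer hξ (V (s + 1)) f (J k)) + k ≤
      Module.finrank K (V (s + 1)) := by
    induction k with
    | zero => exact Submodule.finrank_mono (hle 0)
    | succ k ih =>
      have := Submodule.finrank_lt_finrank_of_lt (hdrop k)
      omega
  -- The dimension cannot drop more often than its initial value.
  have := hrank (Module.finrank K (V (s + 1)) + 1)
  omega

end DetectingFunctional

/-! ### The filtration of `M` and formal integrability. -/

section DifferentialModule

open DiffOp

variable {n m q : ℕ} {K : Type*} [Field K] [PartialDifferentialField n K]

theorem exists_submodule_eq_iterProlong (A : Matrix (Fin n) (Fin n) K)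
    (G : Submodule K (Fin m → DiffOp n K)) (s : ℕ) :
    ∃ S : Submodule K (Fin m → DiffOp n K),
      S.toAddSubgroup = iterProlong (frameOp A) n G.toAddSubgroup s := by
  induction s with
  | zero => exact ⟨G, rfl⟩
  | succ s ih =>
    obtain ⟨S, hS⟩ := ih
    refine ⟨{ (frameSum (frameOp A) S.toAddSubgroup n) with
      smul_mem' := fun a x hx => smul_mem_frameSum_frameOp A a hx }, ?_⟩
    rw [iterProlong, ← hS]

theorem smul_mem_iterProlong (A : Matrix (Fin n) (Fin n) K)
    {G : Submodule K (Fin m → DiffOp n K)} {s : ℕ} {x : Fin m → DiffOp n K} (a : K)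
    (hx : x ∈ iterProlong (frameOp A) n G.toAddSubgroup s) :
    a • x ∈ iterProlong (frameOp A) n G.toAddSubgroup s := by
  obtain ⟨S, hS⟩ := exists_submodule_eq_iterProlong A G s
  rw [← hS] at hx ⊢
  exact S.smul_mem a hx

theorem d_eq_sum_frameOp {A B : Matrix (Fin n) (Fin n) K} (hBA : B * A = 1) (l : Fin n) :
    d K l = ∑ j : Fin n, B l j • frameOp A j := by
  simp only [frameOp_fin, Finset.smul_sum, smul_smul]
  rw [Finset.sum_comm]
  simp only [← Finset.sum_smul, ← Matrix.mul_apply, hBA]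
  rw [Finset.sum_eq_single l]
  · simp
  · intro i _ h; rw [Matrix.one_apply_ne h.symm, zero_smul]
  · simp

/-- The module of equations is the union of the prolongations of the equations. -/
theorem mem_equationModule_iff {A : Matrix (Fin n) (Fin n) K} (hA : IsUnit A)
    (R : Submodule K (Jet K n m q)) {x : Fin m → DiffOp n K} :
    x ∈ equationModule R ↔ ∃ s, x ∈ iterProlong (frameOp A) n (rows R).toAddSubgroup s := by
  have hadd {x y : Fin m → DiffOp n K}
      (hx : ∃ s, x ∈ iterProlong (frameOp A) n (rows R).toAddSubgroup s)
      (hy : ∃ s, y ∈ iterProlong (frameOp A) n (rows R).toAddSubgroup s) :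
      ∃ s, x + y ∈ iterProlong (frameOp A) n (rows R).toAddSubgroup s := by
    obtain ⟨s, hs⟩ := hx
    obtain ⟨t, ht⟩ := hy
    exact ⟨max s t, add_mem (iterProlong_mono n (le_max_left s t) hs)
      (iterProlong_mono n (le_max_right s t) ht)⟩
  constructor
  · intro hx
    induction hx using Submodule.span_induction with
    | mem x hx => exact ⟨0, hx⟩
    | zero => exact ⟨0, zero_mem _⟩
    | add x y _ _ hx hy => exact hadd hx hy
    | smul P x _ hx =>
      induction P using DiffOp.induction_on generalizing x with
      | hc a =>
        obtain ⟨s, hs⟩ := hx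
        exact ⟨s, by rw [coef_smul]; exact smul_mem_iterProlong A a hs⟩
      | hd i =>
        obtain ⟨B, hAB, hBA⟩ := isUnit_iff_exists.mp hA
        obtain ⟨s, hs⟩ := hx
        refine ⟨s + 1, ?_⟩
        rw [d_eq_sum_frameOp hBA, Finset.sum_smul]
        refine sum_mem fun j _ => ?_
        rw [smul_assoc]
        exact smul_mem_iterProlong A _ (smul_mem_frameSum j.2 hs)
      | hadd P Q hP hQ => rw [add_smul]; exact hadd (hP x ‹_› hx) (hQ x ‹_› hx)
      | hmul P Q hP hQ =>
        rw [mul_smul]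
        exact hP _ (Submodule.smul_mem _ _ ‹_›) (hQ x ‹_› hx)
  · rintro ⟨s, hs⟩
    induction s generalizing x with
    | zero => exact Submodule.subset_span hs
    | succ s ih =>
      exact frameSum_induction (p := fun x : Fin m → DiffOp n K => x ∈ equationModule R)
        (fun x hx => ih hx) (fun k _ x hx => Submodule.smul_mem _ _ (ih hx))
        (fun x y hx hy => add_mem hx hy) hs

/-- The residue map `Dᵐ → M` over `K`. -/
def residue (R : Submodule K (Jet K n m q)) : (Fin m → DiffOp n K) →ₗ[K] DModule R :=
  (equationModule R).mkQ.restrictScalars K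

theorem residue_surjective (R : Submodule K (Jet K n m q)) : Function.Surjective (residue R) :=
  (equationModule R).mkQ_surjective

theorem residue_eq_zero {R : Submodule K (Jet K n m q)} {x : Fin m → DiffOp n K} :
    residue R x = 0 ↔ x ∈ equationModule R := Submodule.Quotient.mk_eq_zero _

theorem residue_smul (R : Submodule K (Jet K n m q)) (P : DiffOp n K) (x : Fin m → DiffOp n K) :
    residue R (P • x) = P • residue R x := (equationModule R).mkQ.map_smul P x

theorem freeFil_eq_span (r : ℕ) : freeFil n K m r =
    Submodule.span K {x | ∃ (k : Fin m) (μ : Fin n → ℕ), mlen μ ≤ r ∧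
      x = Pi.single k (monomial μ)} := by
  apply le_antisymm
  · rw [← range_rowMap]
    rintro _ ⟨a, rfl⟩
    rw [rowMap_eq_sum]
    exact Submodule.sum_mem _ fun k _ => Submodule.sum_mem _ fun μ _ =>
      Submodule.smul_mem _ _ (Submodule.subset_span ⟨k, μ.1, μ.2, rfl⟩)
  · refine Submodule.span_le.mpr ?_
    rintro _ ⟨k, μ, hμ, rfl⟩
    exact single_monomial_mem_freeFil k hμ

theorem filtration_eq_map (R : Submodule K (Jet K n m q)) (r : ℕ) :
    DModule.filtration R r = (freeFil n K m r).map (residue R) := by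
  rw [freeFil_eq_span, Submodule.map_span, DModule.filtration]
  congr 1
  ext x
  constructor
  · rintro ⟨k, μ, hμ, rfl⟩
    exact ⟨_, ⟨k, μ, hμ, rfl⟩, rfl⟩
  · rintro ⟨_, ⟨k, μ, hμ, rfl⟩, rfl⟩
    exact ⟨k, μ, hμ, rfl⟩

theorem filtration_mono (R : Submodule K (Jet K n m q)) : Monotone (DModule.filtration R) := by
  intro r s h
  rw [filtration_eq_map, filtration_eq_map]
  exact Submodule.map_mono (freeFil_mono m h)

theorem exists_mem_filtration (R : Submodule K (Jet K n m q)) (x : DModule R) :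
    ∃ r, x ∈ DModule.filtration R r := by
  obtain ⟨y, rfl⟩ := residue_surjective R x
  choose r hr using fun k => exists_mem_orderLE (y k)
  refine ⟨Finset.univ.sup r, ?_⟩
  rw [filtration_eq_map]
  exact ⟨y, mem_freeFil.mpr fun k => orderLE_mono (Finset.le_sup (Finset.mem_univ k)) (hr k), rfl⟩

theorem filtration_eq_range (R : Submodule K (Jet K n m q)) (r : ℕ) :
    DModule.filtration R r = LinearMap.range (residue R ∘ₗ rowMap n m r K) := by
  rw [filtration_eq_map, LinearMap.range_comp, range_rowMap]

instance finite_filtration (R : Submodule K (Jet K n m q)) (r : ℕ) :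
    Module.Finite K (DModule.filtration R r) := by
  rw [filtration_eq_range]
  infer_instance

theorem frameOp_smul_mem_filtration (R : Submodule K (Jet K n m q))
    (A : Matrix (Fin n) (Fin n) K) (j r : ℕ) {x : DModule R}
    (hx : x ∈ DModule.filtration R r) : frameOp A j • x ∈ DModule.filtration R (r + 1) := by
  rw [filtration_eq_map] at hx ⊢
  obtain ⟨y, hy, rfl⟩ := hx
  exact ⟨_, frameOp_smul_mem_freeFil A j hy, residue_smul R _ _⟩

variable {R : Submodule K (Jet K n m q)} {A : Matrix (Fin n) (Fin n) K}

theorem isQuasiRegular_iterProlong (hA : IsUnit A) (hAc : ∀ i j l, pd (n := n) l (A i j) = 0)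
    (h : IsQuasiRegular (frameOp A) n (freeFil n K m q).toAddSubgroup (rows R).toAddSubgroup)
    (s : ℕ) : IsQuasiRegular (frameOp A) n (freeFil n K m (q + s)).toAddSubgroup
      (iterProlong (frameOp A) n (rows R).toAddSubgroup s) :=
  (h.iterProlong (Fr := fun r => (freeFil n K m r).toAddSubgroup) (frameOp_comm hAc)
    (rows_le_freeFil R) (fun _ => frameSum_freeFil_le A n) (isSymbolRegular_freeFil hA m) s).2

/-- Formal integrability: the equations of order `q + s` are the prolongations. -/
theorem mem_iterProlong_of_mem_freeFil (hA : IsUnit A)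
    (hAc : ∀ i j l, pd (n := n) l (A i j) = 0)
    (h : IsQuasiRegular (frameOp A) n (freeFil n K m q).toAddSubgroup (rows R).toAddSubgroup)
    {s : ℕ} {x : Fin m → DiffOp n K} (hx : x ∈ equationModule R)
    (hxs : x ∈ freeFil n K m (q + s)) :
    x ∈ iterProlong (frameOp A) n (rows R).toAddSubgroup s := by
  obtain ⟨t, ht⟩ := (mem_equationModule_iff hA R).mp hx
  exact iterProlong_inf_le (Fr := fun r => (freeFil n K m r).toAddSubgroup)
    (fun _ _ h => freeFil_mono m h) (isQuasiRegular_iterProlong hA hAc h) (t := t)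
    (iterProlong_mono n (Nat.le_add_left t s) ht) hxs

/-- By formal integrability the elements of `DΦ` of order at most `q` are the given equations only,
so `dim M_q` is the codimension of the space of equations. -/
theorem finrank_filtration (hA : IsUnit A) (hAc : ∀ i j l, pd (n := n) l (A i j) = 0)
    (h : IsQuasiRegular (frameOp A) n (freeFil n K m q).toAddSubgroup (rows R).toAddSubgroup) :
    Module.finrank K (DModule.filtration R q) = Module.finrank K R := by
  have hinj : Function.Injective (rowMap n m q K) := by
    refine (injective_iff_map_eq_zero _).mpr fun a ha => ?_
    refine jetPairing_bijective.1 (LinearMap.ext fun v => ?_)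
    rw [jetPairing_apply, ← jetEval_rowMap, ha, map_zero, map_zero, LinearMap.zero_apply]
  have hker : LinearMap.ker (residue R ∘ₗ rowMap n m q K) = equations R := by
    ext a
    rw [LinearMap.mem_ker, LinearMap.comp_apply, residue_eq_zero]
    constructor
    · intro ha
      obtain ⟨b, hb, hab⟩ := mem_iterProlong_of_mem_freeFil (s := 0) hA hAc h ha
        (rowMap_mem_freeFil a)
      exact hinj hab ▸ hb
    · exact fun ha => Submodule.subset_span ⟨a, ha, rfl⟩
  have h1 := LinearMap.finrank_range_add_finrank_ker (residue R ∘ₗ rowMap n m q K)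
  rw [hker, ← filtration_eq_range, ← finrank_add_finrank_equations R] at h1
  exact Nat.add_right_cancel h1

/-- The first vector of the frame raises the order of every element of order greater than `q`. -/
theorem mem_filtration_of_frameOp_smul_mem (hA : IsUnit A)
    (hAc : ∀ i j l, pd (n := n) l (A i j) = 0)
    (h : IsQuasiRegular (frameOp A) n (freeFil n K m q).toAddSubgroup (rows R).toAddSubgroup)
    {s : ℕ} (hs : q ≤ s) {x : DModule R} (hx : x ∈ DModule.filtration R (s + 1))
    (hξx : frameOp A 0 • x ∈ DModule.filtration R (s + 1)) : x ∈ DModule.filtration R s := by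
  rcases Nat.eq_zero_or_pos n with rfl | hn
  -- Without variables every multi-index has length `0` and all the `M_r` coincide.
  · refine Submodule.span_mono ?_ hx
    rintro _ ⟨k, μ, -, rfl⟩
    exact ⟨k, μ, by simp [mlen], rfl⟩
  obtain ⟨t, rfl⟩ := Nat.exists_eq_add_of_le hs
  rw [filtration_eq_map] at hx hξx ⊢
  obtain ⟨y, hy, rfl⟩ := hx
  obtain ⟨z, hz, hyz⟩ := hξx
  rw [← residue_smul, eq_comm, ← sub_eq_zero, ← map_sub, residue_eq_zero] at hyz
  have hy2 : frameOp A 0 • y - z ∈ freeFil n K m (q + (t + 2)) :=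
    sub_mem (frameOp_smul_mem_freeFil A 0 hy) (freeFil_mono m (Nat.le_succ _) hz)
  have h1 := mem_iterProlong_of_mem_freeFil hA hAc h hyz hy2
  -- Quasi-regularity with one frame vector writes `ξ_0 y - z` as `b₀ + ξ_0 b` with `b₀` and `b` in
  -- `DΦ`, of order at most `q + t + 1`. Then `ξ_0 (y - b) = z + b₀` has the same bound on its
  -- order, so regularity lowers the order of the representative `y - b`.
  have h2 := isQuasiRegular_iterProlong hA hAc h (t + 1) 1 hn _ h1
    (mem_frameSum_succ.mpr ⟨-z, neg_mem hz, y, hy, by abel⟩)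
  obtain ⟨b₀, hb₀, b, hb, hyb⟩ := mem_frameSum_succ.mp h2
  have hle := (h.iterProlong (Fr := fun r => (freeFil n K m r).toAddSubgroup) (frameOp_comm hAc)
    (rows_le_freeFil R) (fun _ => frameSum_freeFil_le A n) (isSymbolRegular_freeFil hA m)
    (t + 1)).1
  have h3 : y - b ∈ freeFil n K m (q + t) := by
    refine isSymbolRegular_freeFil hA m (q + t) 0 hn _ (sub_mem hy (hle hb)) ?_
    have e : frameOp A 0 • (y - b) = z + b₀ := by
      rw [smul_sub, ← sub_eq_zero]
      rw [← sub_eq_zero] at hyb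
      rw [← hyb]
      abel
    rw [e]
    exact add_mem hz (hle hb₀)
  refine ⟨_, h3, ?_⟩
  rw [map_sub, sub_eq_self, residue_eq_zero]
  exact (mem_equationModule_iff hA R).mpr ⟨_, hb⟩

end DifferentialModule

/-! ### Separation of points and density. -/

section Density

open DiffOp

variable {n m q : ℕ} {K : Type*} [Field K] [PartialDifferentialField n K]

/-- The vectors killed by a `D`-submodule of the inverse system form a `D`-submodule. -/
theorem smul_apply_eq_zero {M : Type*} [AddCommGroup M] [Module K M] [Module (DiffOp n K) M]
    [IsScalarTower K (DiffOp n K) M] (S : Submodule (DiffOp n K) (M →ₗ[K] K)) {x : M}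
    (hx : ∀ h ∈ S, h x = 0) (P : DiffOp n K) : ∀ h ∈ S, h (P • x) = 0 := by
  induction P using DiffOp.induction_on generalizing x with
  | hc a => intro h hh; rw [coef_smul, map_smul, hx h hh, smul_zero]
  | hd i =>
    intro h hh
    -- In `(d_i h)(x) = ∂_i (h x) - h (d_i x)` both `(d_i h)(x)` and `h x` vanish.
    have := hx _ (S.smul_mem (d K i) hh)
    rwa [d_smul_apply, hx h hh, map_zero, zero_sub, neg_eq_zero] at this
  | hadd P Q hP hQ =>
    intro h hh; rw [add_smul, map_add, hP hx h hh, hQ hx h hh, add_zero]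
  | hmul P Q hP hQ =>
    intro h hh; rw [mul_smul]; exact hP (hQ hx) h hh

/-- A `D`-submodule of the inverse system that separates points restricts onto the dual of every
finite-dimensional subspace. -/
theorem exists_domRestrict_eq {M : Type*} [AddCommGroup M] [Module K M] [Module (DiffOp n K) M]
    [IsScalarTower K (DiffOp n K) M] {S : Submodule (DiffOp n K) (M →ₗ[K] K)}
    (hS : ∀ x, (∀ h ∈ S, h x = 0) → x = 0) (V : Submodule K M) [Module.Finite K V]
    (g : V →ₗ[K] K) : ∃ h ∈ S, h.domRestrict V = g := by
  let W : Submodule K (Module.Dual K V) :=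
    { carrier := {g | ∃ h ∈ S, h.domRestrict V = g}
      zero_mem' := ⟨0, S.zero_mem, rfl⟩
      add_mem' := by
        rintro _ _ ⟨h, hh, rfl⟩ ⟨h', hh', rfl⟩
        exact ⟨h + h', S.add_mem hh hh', rfl⟩
      smul_mem' := by
        rintro a _ ⟨h, hh, rfl⟩
        refine ⟨coef n a • h, S.smul_mem _ hh, LinearMap.ext fun x => ?_⟩
        exact coef_smul_apply a h x }
  -- In finite dimension a space of linear forms with zero common kernel is the whole dual.
  have hW : W.dualCoannihilator = ⊥ := by
    refine (Submodule.eq_bot_iff _).mpr fun x hx => Subtype.ext (hS x fun h hh => ?_)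
    exact (Submodule.mem_dualCoannihilator x).mp hx _ ⟨h, hh, rfl⟩
  have hW' : W = ⊤ := by
    rw [← Subspace.dualCoannihilator_dualAnnihilator_eq (W := W), hW,
      Submodule.dualAnnihilator_bot]
  exact (hW' ▸ Submodule.mem_top : g ∈ W)

theorem filtration_eq_top_of_finite (R : Submodule K (Jet K n m q))
    [Module.Finite K (DModule R)] : ∃ r, DModule.filtration R r = ⊤ := by
  obtain ⟨s, hs⟩ := Module.Finite.fg_top (R := K) (M := DModule R)
  choose r hr using exists_mem_filtration R
  refine ⟨s.sup r, eq_top_iff.mpr ?_⟩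
  rw [← hs]
  exact Submodule.span_le.mpr fun x hx => filtration_mono R (Finset.le_sup hx) (hr x)

/-- The residues of the `y^k` generate `M` over `D` and already lie in every `M_r`. -/
theorem eq_zero_of_filtration_eq_bot {R : Submodule K (Jet K n m q)} {r : ℕ}
    (h : DModule.filtration R r = ⊥) (x : DModule R) : x = 0 := by
  obtain ⟨y, rfl⟩ := residue_surjective R x
  have hy : y = ∑ k, y k • (Pi.single k (monomial (K := K) 0) : Fin m → DiffOp n K) := by
    funext k
    simp only [Finset.sum_apply, Pi.smul_apply, smul_eq_mul, monomial_zero]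
    rw [Finset.sum_eq_single k]
    · simp
    · intro l _ hl; rw [Pi.single_eq_of_ne hl.symm, mul_zero]
    · simp
  rw [hy, map_sum]
  refine Finset.sum_eq_zero fun k _ => ?_
  have hk : residue R (Pi.single k (monomial 0)) ∈ DModule.filtration R r :=
    Submodule.subset_span ⟨k, 0, by simp [mlen], rfl⟩
  rw [h, Submodule.mem_bot] at hk
  rw [residue_smul, hk, smul_zero]

end Density

end

theorem corollary3p39 {n m q : ℕ} {K : Type*} [Field K] [CharZero K]
    [PartialDifferentialField n K] (R : Submodule K (Jet K n m q)) (hR : IsInvolutive R) :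
    ∃ f : Fin (Module.finrank K R) → (DModule R →ₗ[K] K),
      LinearIndependent K f ∧
      (∀ (r : ℕ) (g : DModule.filtration R r →ₗ[K] K),
        ∃ h ∈ Submodule.span (DiffOp n K) (Set.range f),
          h.domRestrict (DModule.filtration R r) = g) ∧
      (Module.Finite K (DModule R) →
        Submodule.span (DiffOp n K) (Set.range f) = ⊤) := by
  obtain ⟨hproj, A, hA, hAc, hdim⟩ := hR
  have hreg := isQuasiRegular_rows hproj hA hAc hdim
  set V := DModule.filtration R
  have hrank : Module.finrank K (Module.Dual K (V q)) = Module.finrank K R := by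
    rw [Subspace.dual_finrank_eq]
    exact finrank_filtration hA hAc hreg
  let e := Module.finBasisOfFinrankEq K (Module.Dual K (V q)) hrank
  -- Any extension serves: only its values on `M_q` are kept when the detecting form is built.
  choose e' he' using fun i => LinearMap.exists_extend (e i)
  let ξ : DModule R →+ DModule R :=
    DistribSMul.toAddMonoidHom (DModule R) (DiffOp.frameOp A 0)
  have hdet (i) := exists_detecting_functional (V := V) (ξ := ξ) (q := q)
    (δ := DiffOp.frameDer A 0) (filtration_mono R) (exists_mem_filtration R)
    (finite_filtration R) (DiffOp.frameOp_smul_smul A 0)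
    (fun r _ hx => frameOp_smul_mem_filtration R A 0 r hx)
    (fun s hs _ => mem_filtration_of_frameOp_smul_mem hA hAc hreg hs) (e' i)
  choose f hfe hf using hdet
  have hfe' (i) : (f i).domRestrict (V q) = e i := by
    rw [← he' i]
    exact LinearMap.ext fun x => hfe i x x.2
  have hsep : ∀ x, (∀ h ∈ Submodule.span (DiffOp n K) (Set.range f), h x = 0) → x = 0 := by
    intro x hx
    by_cases hxq : x ∈ V q
    · have : (⟨x, hxq⟩ : V q) = 0 := by
        refine (Module.forall_dual_apply_eq_zero_iff K _).mp fun φ => ?_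
        rw [← e.sum_repr φ, LinearMap.sum_apply]
        refine Finset.sum_eq_zero fun i _ => ?_
        rw [LinearMap.smul_apply, ← hfe' i]
        exact smul_eq_zero_of_right _ (hx _ (Submodule.subset_span ⟨i, rfl⟩))
      exact congrArg Subtype.val this
    · obtain ⟨s, hs, hxs, hxs'⟩ : ∃ s ≥ q, x ∈ V (s + 1) ∧ x ∉ V s := by
        classical
        have hex := exists_mem_filtration R x
        have hlt : q < Nat.find hex := by
          by_contra! hle
          exact hxq (filtration_mono R hle (Nat.find_spec hex))
        refine ⟨Nat.find hex - 1, by omega, ?_, Nat.find_min hex (by omega)⟩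
        rw [Nat.sub_add_cancel (by omega)]
        exact Nat.find_spec hex
      -- Detection needs one form. If there is none, then `M_q = 0` and hence `M = 0`.
      rcases Nat.eq_zero_or_pos (Module.finrank K R) with h0 | hpos
      · refine eq_zero_of_filtration_eq_bot (r := q) ?_ x
        rw [← Submodule.finrank_eq_zero (R := K), finrank_filtration hA hAc hreg, h0]
      · obtain ⟨j, hj⟩ := hf ⟨0, hpos⟩ s hs x hxs hxs'
        refine absurd ?_ hj
        have hiter : ξ^[j] x = DiffOp.frameOp A 0 ^ j • x := by
          clear hj
          induction j with
          | zero => rw [pow_zero, one_smul]; rfl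
          | succ j ih => rw [Function.iterate_succ_apply', ih, pow_succ', mul_smul]; rfl
        rw [hiter]
        exact smul_apply_eq_zero _ hx _ _ (Submodule.subset_span ⟨_, rfl⟩)
  have hsurj (r : ℕ) (g : V r →ₗ[K] K) := exists_domRestrict_eq hsep (V r) g
  refine ⟨f, ?_, hsurj, fun hfin => ?_⟩
  -- Independence is already visible on `M_q`, where the forms restrict to a basis of the dual.
  · refine LinearIndependent.of_comp (Submodule.dualRestrict (V q)) ?_
    have : Submodule.dualRestrict (V q) ∘ f = e := funext hfe'
    rw [this]
    exact e.linearIndependent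
  · obtain ⟨r, hr⟩ := filtration_eq_top_of_finite R
    refine eq_top_iff.mpr fun g _ => ?_
    obtain ⟨h, hh, hg⟩ := hsurj r (g.domRestrict (V r))
    have : h = g := LinearMap.ext fun x =>
      LinearMap.congr_fun hg (⟨x, hr.ge Submodule.mem_top⟩ : V r)
    exact this ▸ hh
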